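/- A (semigroup) identity is a pair $u\approx v$ of words in the free semigroup $\mathfrak A^+$ over a countably infinite alphabet $\mathfrak A$; a semigroup $S$ satisfies it if $\varphi(u)=\varphi(v)$ for every homomorphism $\varphi:\mathfrak A^+\to S$. A semigroup is finitely based if there is a finite set of identities of $S$ from which all identities of $S$ can be deduced, and non-finitely based otherwise. Let $A_0=\langle a,b \mid aa=a,\ bb=b,\ ab=0\rangle$ (a presentation as a semigroup with zero $0$), and let $A_0^1$ be the monoid obtained by adjoining an identity element to $A_0$. For a set $W$ of words in the free monoid $\mathfrak A^*$, let $S(W)$ be the Rees quotient of $\mathfrak A^*$ over the ideal of all words that are not subwords (blocks of consecutive letters) of words in $W$. Let $a,t\in\mathfrak A$ be distinct letters and, for $i=1,2,\dots$, let $W_i=\{a^{i+1-d}\,t\,a^{d} : 0<d<i+1\}$ (so $W_1=\{ata\}$, $W_2=\{a^2ta,\ ata^2\}$, $W_3=\{a^3ta,\ a^2ta^2,\ ata^3\}$, \dots). Then $A_0^1$ is finitely based and, for every $i=1,2,\dots$, the monoid $S(W_i)$ is finitely based, while the direct product $A_0^1\times S(W_i)$ is non-finitely based. -/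

import Mathlib

namespace FiniteBasis

/-- The countable alphabet of variables. -/
abbrev Alphabet : Type := ℕ

/-- A (semigroup) identity `u ≈ v`: a pair of words of the free semigroup over the alphabet. -/
abbrev Identity : Type := FreeSemigroup Alphabet × FreeSemigroup Alphabet

/-- The semigroup `S` satisfies the identity `u ≈ v`: every evaluation of the variables in `S`
gives both words the same value. -/
def Satisfies (S : Type*) [Semigroup S] (e : Identity) : Prop :=
  ∀ φ : FreeSemigroup Alphabet →ₙ* S, φ e.1 = φ e.2

/-- The identity `e` can be deduced from `E`: its sides are related by the congruence on the free
semigroup generated by all pairs `Θ u, Θ v` with `u ≈ v` in `E` and `Θ` a substitution. -/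
def Deducible (E : Set Identity) (e : Identity) : Prop :=
  conGen (fun p q : FreeSemigroup Alphabet =>
    ∃ f ∈ E, ∃ Θ : FreeSemigroup Alphabet →ₙ* FreeSemigroup Alphabet,
      p = Θ f.1 ∧ q = Θ f.2) e.1 e.2

/-- `S` is finitely based: some finite set of identities of `S` implies all identities of `S`. -/
def FinitelyBased (S : Type*) [Semigroup S] : Prop :=
  ∃ E : Set Identity, E.Finite ∧ (∀ e ∈ E, Satisfies S e) ∧
    ∀ e : Identity, Satisfies S e → Deducible E e

/-- The two generators of `A₀`. -/
inductive A0Gen : Type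
  | a
  | b

/-- A generator as an element of the free semigroup with zero. -/
def A0Gen.toWord (g : A0Gen) : WithZero (FreeSemigroup A0Gen) :=
  ((FreeSemigroup.of g : FreeSemigroup A0Gen) : WithZero (FreeSemigroup A0Gen))

/-- The defining relations `aa = a`, `bb = b`, `ab = 0`. -/
inductive A0Rel : WithZero (FreeSemigroup A0Gen) → WithZero (FreeSemigroup A0Gen) → Prop
  | aa : A0Rel (A0Gen.a.toWord * A0Gen.a.toWord) A0Gen.a.toWord
  | bb : A0Rel (A0Gen.b.toWord * A0Gen.b.toWord) A0Gen.b.toWord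
  | ab : A0Rel (A0Gen.a.toWord * A0Gen.b.toWord) 0

/-- The semigroup `A₀ = ⟨a, b ∣ aa = a, bb = b, ab = 0⟩`, presented as a semigroup with zero. -/
abbrev A0 : Type := (conGen A0Rel).Quotient

/-- The monoid `A₀¹`, obtained by adjoining an identity element to `A₀`. -/
abbrev A0One : Type := WithOne A0

/-- `w` is a subword (a block of consecutive letters) of a word in `W`. -/
def IsSubwordOf (W : Set (FreeMonoid Alphabet)) (w : FreeMonoid Alphabet) : Prop :=
  ∃ w' ∈ W, ∃ p q : FreeMonoid Alphabet, w' = p * w * q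

theorem IsSubwordOf.left {W : Set (FreeMonoid Alphabet)} {u v : FreeMonoid Alphabet}
    (h : IsSubwordOf W (u * v)) : IsSubwordOf W u := by
  obtain ⟨w', hw', p, q, rfl⟩ := h
  exact ⟨_, hw', p, v * q, by simp only [mul_assoc]⟩

theorem IsSubwordOf.right {W : Set (FreeMonoid Alphabet)} {u v : FreeMonoid Alphabet}
    (h : IsSubwordOf W (u * v)) : IsSubwordOf W v := by
  obtain ⟨w', hw', p, q, rfl⟩ := h
  exact ⟨_, hw', p * u, q, by simp only [mul_assoc]⟩

/-- The Rees congruence of the ideal of all words that are not subwords of words in `W`. -/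
def reesCon (W : Set (FreeMonoid Alphabet)) : Con (FreeMonoid Alphabet) where
  r u v := u = v ∨ (¬ IsSubwordOf W u ∧ ¬ IsSubwordOf W v)
  iseqv :=
    { refl := fun _ => Or.inl rfl
      symm := by
        rintro u v (rfl | ⟨h, h'⟩)
        · exact Or.inl rfl
        · exact Or.inr ⟨h', h⟩
      trans := by
        rintro u v w (rfl | ⟨h, h'⟩) (rfl | ⟨k, k'⟩)
        · exact Or.inl rfl
        · exact Or.inr ⟨k, k'⟩
        · exact Or.inr ⟨h, h'⟩
        · exact Or.inr ⟨h, k'⟩ }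
  mul' := by
    rintro u v x y (rfl | ⟨h, h'⟩) (rfl | ⟨k, k'⟩)
    · exact Or.inl rfl
    · exact Or.inr ⟨fun s => k s.right, fun s => k' s.right⟩
    · exact Or.inr ⟨fun s => h s.left, fun s => h' s.left⟩
    · exact Or.inr ⟨fun s => h s.left, fun s => h' s.left⟩

/-- The monoid `S(W)`: the Rees quotient of the free monoid over the ideal of all words that are
not subwords of words in `W`. -/
abbrev SMonoid (W : Set (FreeMonoid Alphabet)) : Type := (reesCon W).Quotient

/-- `W_i = {a^(i+1-d) t a^d : 0 < d < i + 1}`. -/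
def wordSet (a t : Alphabet) (i : ℕ) : Set (FreeMonoid Alphabet) :=
  {w | ∃ d : ℕ, 0 < d ∧ d < i + 1 ∧
    w = FreeMonoid.of a ^ (i + 1 - d) * FreeMonoid.of t * FreeMonoid.of a ^ d}

end FiniteBasis

/-! Both factors are monoids, so an identity may be applied with letters replaced by empty words,
and satisfaction can be tested letter by letter (`Sat`).

An identity holds in A₀¹ iff its sides have the same letters and the same scattered subwords of
length two (`sat_A0One_iff`). For two such words with a common prefix followed by different letters,
the next letter of one can always be inserted into the other without changing these data
(`sub2_insert_or`). Each insertion follows from short identities that delete an inner occurrence or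
swap neighbours (`derives_insert`), and it lengthens the common prefix.

In S(W_i) a letter occurring at least twice can only take a power of a as value if the product is to
be nonzero. So adjacent non-linear letters commute (`sat_swap`), where a linear letter is one
occurring exactly once. Call x free in u if it occurs at least i+2 times, or i+1 times with no
linear letter between two occurrences. Any value other than 1 for a free letter gives 0, so a free
letter can be gathered into a prefix x^(i+1) and removed from both sides (`derives_of_free`). Once
no letter is free, an identity fixes all multiplicities and all positions relative to linear letters
(`samePositions_of_sat`), and swaps suffice.

For the product, consider z₀z₁⋯ t x^m y₀z₀y₁z₁⋯ x t' y₀y₁⋯ with m = i and m = i+1. The letter x is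
free in both words and they have the same pairs, so this is an identity of the product. Suppose a
short identity α ≈ β changes the number of x in a word equivalent to the first one and having i+1
letters x. Then some letter ξ of α carries all the x, and the part of α from its first to its last ξ
consists of repeated letters. The image of this part must cover nearly all the right-hand z_j, while
one repeated letter can cover only one of them (`length_of_cover`). Hence α has at least about n
letters, where n is the number of z_j, and no finite set of identities suffices. -/

namespace FiniteBasis

/-! ### Words, evaluations and deductions from identities of bounded size -/

/-- The list of letters of an element of the free semigroup. -/
def toWord (p : FreeSemigroup ℕ) : List ℕ := p.head :: p.tail

theorem toWord_of (x : ℕ) : toWord (FreeSemigroup.of x) = [x] := rfl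

theorem toWord_mul (p q : FreeSemigroup ℕ) : toWord (p * q) = toWord p ++ toWord q := rfl

theorem toWord_ne_nil (p : FreeSemigroup ℕ) : toWord p ≠ [] := List.cons_ne_nil _ _

theorem toWord_injective : Function.Injective toWord := by
  rintro ⟨x, l⟩ ⟨y, m⟩ h
  simp only [toWord, List.cons.injEq] at h
  rw [h.1, h.2]

theorem exists_toWord {l : List ℕ} (h : l ≠ []) : ∃ p, toWord p = l := by
  cases l with
  | nil => exact absurd rfl h
  | cons x l => exact ⟨⟨x, l⟩, rfl⟩

/-- Every evaluation of the letters in the monoid `S` gives `u` and `v` the same value. -/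
def Sat (S : Type*) [Monoid S] (u v : List ℕ) : Prop :=
  ∀ φ : ℕ → S, (u.map φ).prod = (v.map φ).prod

theorem map_eq_prod {S : Type*} [Monoid S] (φ : FreeSemigroup ℕ →ₙ* S) (p : FreeSemigroup ℕ) :
    φ p = ((toWord p).map fun x => φ (FreeSemigroup.of x)).prod := by
  induction p using FreeSemigroup.recOnMul with
  | ih1 x => simp [toWord_of]
  | ih2 x y hx hy => rw [map_mul, toWord_mul, List.map_append, List.prod_append, hx, hy]

theorem satisfies_iff {S : Type*} [Monoid S] (e : Identity) :
    Satisfies S e ↔ Sat S (toWord e.1) (toWord e.2) := by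
  constructor
  · intro h φ
    have := h (FreeSemigroup.lift φ)
    simpa [map_eq_prod] using this
  · intro h φ
    rw [map_eq_prod, map_eq_prod]
    exact h _

theorem toWord_map (Θ : FreeSemigroup ℕ →ₙ* FreeSemigroup ℕ) (p : FreeSemigroup ℕ) :
    toWord (Θ p) = (toWord p).flatMap fun x => toWord (Θ (FreeSemigroup.of x)) := by
  induction p using FreeSemigroup.recOnMul with
  | ih1 x => simp [toWord_of]
  | ih2 x y hx hy => rw [map_mul, toWord_mul, toWord_mul, List.flatMap_append, hx, hy]

namespace Sat

variable {S : Type*} [Monoid S] {u v w : List ℕ}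

theorem refl (u : List ℕ) : Sat S u u := fun _ => rfl

theorem symm (h : Sat S u v) : Sat S v u := fun φ => (h φ).symm

theorem trans (h : Sat S u v) (k : Sat S v w) : Sat S u w := fun φ => (h φ).trans (k φ)

theorem context (h : Sat S u v) (p q : List ℕ) : Sat S (p ++ u ++ q) (p ++ v ++ q) := by
  intro φ
  simp only [List.map_append, List.prod_append, h φ]

theorem map_flatMap_prod (φ : ℕ → S) (θ : ℕ → List ℕ) (u : List ℕ) :
    ((u.flatMap θ).map φ).prod = (u.map fun x => ((θ x).map φ).prod).prod := by
  induction u with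
  | nil => rfl
  | cons x u ih => simp [ih]

theorem subst (h : Sat S u v) (θ : ℕ → List ℕ) : Sat S (u.flatMap θ) (v.flatMap θ) := by
  intro φ
  rw [map_flatMap_prod, map_flatMap_prod]
  exact h _

theorem flatMap_ite_singleton (P : ℕ → Bool) (u : List ℕ) :
    (u.flatMap fun x => if P x then [x] else []) = u.filter P := by
  induction u with
  | nil => rfl
  | cons x u ih => by_cases h : P x <;> simp [h, ih]

theorem filter (h : Sat S u v) (P : ℕ → Bool) : Sat S (u.filter P) (v.filter P) := by
  rw [← flatMap_ite_singleton, ← flatMap_ite_singleton]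
  exact h.subst _

end Sat

theorem sat_prod_iff {S T : Type*} [Monoid S] [Monoid T] {u v : List ℕ} :
    Sat (S × T) u v ↔ Sat S u v ∧ Sat T u v := by
  constructor
  · intro h
    refine ⟨fun φ => ?_, fun φ => ?_⟩
    · have := congrArg (MonoidHom.fst S T) (h fun x => (φ x, 1))
      rw [map_list_prod, map_list_prod, List.map_map, List.map_map] at this
      exact this
    · have := congrArg (MonoidHom.snd S T) (h fun x => (1, φ x))
      rw [map_list_prod, map_list_prod, List.map_map, List.map_map] at this
      exact this
  · rintro ⟨h, k⟩ φ
    refine Prod.ext ?_ ?_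
    · have := h fun x => (φ x).1
      rw [← MonoidHom.coe_fst, map_list_prod, map_list_prod, List.map_map, List.map_map]
      exact this
    · have := k fun x => (φ x).2
      rw [← MonoidHom.coe_snd, map_list_prod, map_list_prod, List.map_map, List.map_map]
      exact this

theorem sat_iff_of_injective {S T : Type*} [Monoid S] [Monoid T] (f : S →* T)
    (hf : Function.Injective f) (hs : Function.Surjective f) {u v : List ℕ} :
    Sat S u v ↔ Sat T u v := by
  constructor
  · intro h φ
    choose g hg using hs
    have := congrArg f (h fun x => g (φ x))
    simpa only [map_list_prod, List.map_map, Function.comp_def, hg] using this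
  · intro h φ
    apply hf
    simpa only [map_list_prod, List.map_map, Function.comp_def] using h fun x => f (φ x)

/-- The words `u` and `v` are both empty, or `u ≈ v` can be deduced from `E`. -/
def Derives (E : Set Identity) (u v : List ℕ) : Prop :=
  (u = [] ∧ v = []) ∨ ∃ p q, toWord p = u ∧ toWord q = v ∧ Deducible E (p, q)

namespace Derives

variable {E : Set Identity} {u v w : List ℕ}

theorem refl (u : List ℕ) : Derives E u u := by
  by_cases h : u = []
  · exact Or.inl ⟨h, h⟩
  · obtain ⟨p, rfl⟩ := exists_toWord h
    exact Or.inr ⟨p, p, rfl, rfl, Con.refl _ _⟩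

theorem of_eq (h : u = v) : Derives E u v := h ▸ refl u

theorem symm (h : Derives E u v) : Derives E v u := by
  rcases h with ⟨rfl, rfl⟩ | ⟨p, q, rfl, rfl, h⟩
  · exact refl _
  · exact Or.inr ⟨q, p, rfl, rfl, Con.symm _ h⟩

theorem trans (h : Derives E u v) (k : Derives E v w) : Derives E u w := by
  rcases h with ⟨rfl, rfl⟩ | ⟨p, q, rfl, rfl, h⟩
  · exact k
  · rcases k with ⟨k, _⟩ | ⟨p', q', hp, rfl, k⟩
    · exact absurd k (toWord_ne_nil q)
    · obtain rfl := toWord_injective hp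
      exact Or.inr ⟨p, q', rfl, rfl, Con.trans _ h k⟩

theorem append {u' v' : List ℕ} (h : Derives E u v) (k : Derives E u' v') :
    Derives E (u ++ u') (v ++ v') := by
  rcases h with ⟨rfl, rfl⟩ | ⟨p, q, rfl, rfl, h⟩
  · exact k
  · rcases k with ⟨rfl, rfl⟩ | ⟨p', q', rfl, rfl, k⟩
    · rw [List.append_nil, List.append_nil]
      exact Or.inr ⟨p, q, rfl, rfl, h⟩
    · exact Or.inr ⟨p * p', q * q', rfl, rfl, Con.mul _ h k⟩

theorem context (h : Derives E u v) (p q : List ℕ) : Derives E (p ++ u ++ q) (p ++ v ++ q) :=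
  ((refl p).append h).append (refl q)

end Derives

/-- A word of length at most `N` in the letters below `N`. -/
def Bounded (N : ℕ) (u : List ℕ) : Prop := u.length ≤ N ∧ ∀ x ∈ u, x < N

theorem finite_bounded (N : ℕ) : {u | Bounded N u}.Finite := by
  refine ((List.finite_length_le (Fin N) N).image (List.map Fin.val)).subset ?_
  rintro u ⟨h, k⟩
  refine ⟨u.pmap (fun x hx => ⟨x, hx⟩) k, by simpa using h, ?_⟩
  rw [List.map_pmap]
  simp

/-- All identities of `S` between words of length at most `N` in the letters below `N`. -/
def boundedIdentities (S : Type*) [Monoid S] (N : ℕ) : Set Identity :=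
  {e | Satisfies S e ∧ Bounded N (toWord e.1) ∧ Bounded N (toWord e.2)}

theorem finite_boundedIdentities (S : Type*) [Monoid S] (N : ℕ) :
    (boundedIdentities S N).Finite := by
  have h := (finite_bounded N).preimage toWord_injective.injOn
  exact (h.prod h).subset fun e he => ⟨he.2.1, he.2.2⟩

/-- Taking all identities up to a size bound avoids an explicit basis: the set is finite, and it is
closed under deletion of letters. -/
theorem finitelyBased_of_derives {S : Type*} [Monoid S] (N : ℕ)
    (h : ∀ u v, Sat S u v → Derives (boundedIdentities S N) u v) : FinitelyBased S := by
  refine ⟨_, finite_boundedIdentities S N, fun e he => he.1, fun e he => ?_⟩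
  rcases h _ _ ((satisfies_iff e).1 he) with ⟨h, _⟩ | ⟨p, q, hp, hq, h⟩
  · exact absurd h (toWord_ne_nil _)
  · obtain rfl := toWord_injective hp.symm
    obtain rfl := toWord_injective hq.symm
    exact h

theorem Bounded.filter {N : ℕ} {u : List ℕ} (h : Bounded N u) (P : ℕ → Bool) :
    Bounded N (u.filter P) :=
  ⟨(List.length_filter_le _ _).trans h.1, fun x hx => h.2 x (List.mem_of_mem_filter hx)⟩

theorem flatMap_filter_isEmpty (θ : ℕ → List ℕ) (u : List ℕ) :
    (u.filter fun x => !(θ x).isEmpty).flatMap θ = u.flatMap θ := by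
  induction u with
  | nil => rfl
  | cons x u ih => by_cases h : θ x = [] <;> simp [h, ih]

theorem flatMap_congr_mem {θ η : ℕ → List ℕ} {u : List ℕ} (h : ∀ x ∈ u, θ x = η x) :
    u.flatMap θ = u.flatMap η := by
  rw [List.flatMap_def, List.flatMap_def, List.map_congr_left h]

/-- An identity of bounded size may be applied with letters replaced by possibly empty words. -/
theorem derives_subst {S : Type*} [Monoid S] {N : ℕ} {u v : List ℕ} (hs : Sat S u v)
    (hc : ∀ x, x ∈ u ↔ x ∈ v) (hu : Bounded N u) (hv : Bounded N v) (θ : ℕ → List ℕ) :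
    Derives (boundedIdentities S N) (u.flatMap θ) (v.flatMap θ) := by
  -- Deduction only allows nonempty substitutions, so letters with empty image are first deleted.
  -- The shortened identity still holds and still obeys the bound.
  rw [← flatMap_filter_isEmpty θ u, ← flatMap_filter_isEmpty θ v]
  set P : ℕ → Bool := fun x => !(θ x).isEmpty
  have hc' : ∀ x, x ∈ u.filter P ↔ x ∈ v.filter P := by simp [hc]
  by_cases hn : u.filter P = []
  · have hn' : v.filter P = [] := by
      rw [List.eq_nil_iff_forall_not_mem] at hn ⊢
      exact fun x hx => hn x ((hc' x).2 hx)
    exact Or.inl (by simp [hn, hn'])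
  · have hn' : v.filter P ≠ [] := by
      intro h
      rw [List.eq_nil_iff_forall_not_mem] at h
      exact hn (List.eq_nil_iff_forall_not_mem.2 fun x hx => h x ((hc' x).1 hx))
    obtain ⟨p, hp⟩ := exists_toWord hn
    obtain ⟨q, hq⟩ := exists_toWord hn'
    have hex : ∀ x, ∃ r, P x = true → toWord r = θ x := by
      intro x
      by_cases hx : θ x = []
      · exact ⟨FreeSemigroup.of x, fun h => by simp [P, hx] at h⟩
      · obtain ⟨r, hr⟩ := exists_toWord hx
        exact ⟨r, fun _ => hr⟩
    choose r hr using hex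
    have key : ∀ (s : FreeSemigroup ℕ) (w : List ℕ), toWord s = w.filter P →
        toWord (FreeSemigroup.lift r s) = (w.filter P).flatMap θ := by
      intro s w hsw
      rw [toWord_map, hsw]
      exact flatMap_congr_mem fun x hx => by
        rw [FreeSemigroup.lift_of]
        exact hr x (List.mem_filter.1 hx).2
    refine Or.inr ⟨FreeSemigroup.lift r p, FreeSemigroup.lift r q, key p u hp, key q v hq, ?_⟩
    refine ConGen.Rel.of _ _ ⟨(p, q), ⟨?_, ?_, ?_⟩, FreeSemigroup.lift r, rfl, rfl⟩
    · rw [satisfies_iff, hp, hq]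
      exact hs.filter P
    · rw [hp]
      exact hu.filter P
    · rw [hq]
      exact hv.filter P

/-! ### The identities of A₀¹ -/

/-- A concrete copy of the monoid `A₀¹`. -/
inductive C3 : Type
  | e
  | a
  | b
  | ba
  | z
  deriving DecidableEq

namespace C3

instance : Fintype C3 := ⟨{e, a, b, ba, z}, by intro x; cases x <;> decide⟩

/-- The multiplication of `C3`. -/
def mul : C3 → C3 → C3
  | e, y => y
  | x, e => x
  | z, _ => z
  | _, z => z
  | a, a => a
  | a, _ => z
  | b, a => ba
  | b, b => b
  | b, ba => ba
  | ba, a => ba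
  | ba, _ => z

instance : Monoid C3 where
  one := e
  mul := mul
  mul_assoc := by decide
  one_mul := by decide
  mul_one := by decide

/-- An extra factor never revives a zero product, by inspection of the table. The prefix product `g`
makes the induction go through. -/
theorem prod_eq_z_of_sublist {l m : List C3} (h : l.Sublist m) :
    ∀ g : C3, g * l.prod = z → g * m.prod = z := by
  induction h with
  | slnil => exact fun g h => h
  | cons c _ ih =>
    intro g hg
    rw [List.prod_cons, ← mul_assoc]
    exact ih _ ((by decide : ∀ g c h : C3, g * h = z → g * c * h = z) _ _ _ hg)
  | cons_cons c _ ih =>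
    intro g hg
    rw [List.prod_cons, ← mul_assoc] at hg ⊢
    exact ih _ hg

/-- When no pair of factors vanishes, every factor `b` precedes every factor `a`, so idempotency
collapses the product to one `b` and one `a`. The value then depends only on which elements occur.
-/
theorem prod_eq_of_forall_ne {m : List C3} (hz : z ∉ m)
    (h : ∀ p q, [p, q].Sublist m → p * q ≠ z) :
    m.prod = (if b ∈ m ∨ ba ∈ m then b else 1) * (if a ∈ m ∨ ba ∈ m then a else 1) := by
  induction m with
  | nil => rfl
  | cons g m ih =>
    have hq : ∀ q ∈ m, g * q ≠ z := fun q hq =>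
      h g q (List.Sublist.cons_cons g (List.singleton_sublist.2 hq))
    rw [List.prod_cons, ih (fun k => hz (List.mem_cons_of_mem _ k))
      fun p q k => h p q (k.cons g)]
    have hb : (g = a ∨ g = ba) → b ∉ m := by
      rintro (rfl | rfl) k
      · exact hq _ k rfl
      · exact hq _ k rfl
    have hba : (g = a ∨ g = ba) → ba ∉ m := by
      rintro (rfl | rfl) k
      · exact hq _ k rfl
      · exact hq _ k rfl
    have hgz : g ≠ z := fun k => hz (by simp [k])
    by_cases h1 : b ∈ m <;> by_cases h2 : ba ∈ m <;> by_cases h3 : a ∈ m <;> cases g <;>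
      simp_all <;> rfl

theorem prod_map_eq_z_iff (φ : ℕ → C3) (u : List ℕ) :
    (u.map φ).prod = z ↔
      (∃ x ∈ u, φ x = z) ∨ ∃ x y, [x, y].Sublist u ∧ φ x * φ y = z := by
  constructor
  · intro h
    by_contra! hc
    rw [prod_eq_of_forall_ne] at h
    · revert h
      split_ifs <;> decide
    · simpa using hc.1
    · intro p q hpq
      obtain ⟨l, hl, hm⟩ := List.sublist_map_iff.1 hpq
      match l, hm with
      | [x, y], hm =>
        simp only [List.map_cons, List.map_nil, List.cons.injEq, and_true] at hm
        rw [hm.1, hm.2]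
        exact hc.2 x y hl
  · rintro (⟨x, hx, h⟩ | ⟨x, y, hxy, h⟩)
    · have := prod_eq_z_of_sublist ((List.singleton_sublist.2 hx).map φ) 1
      simpa [h] using this
    · have := prod_eq_z_of_sublist (hxy.map φ) 1
      simpa [h] using this

end C3

/-- The words `u` and `v` have the same scattered subwords of length at most two. -/
def Sub2 (u v : List ℕ) : Prop :=
  (∀ x, x ∈ u ↔ x ∈ v) ∧ ∀ x y, [x, y].Sublist u ↔ [x, y].Sublist v

/-- Sending x to `z` detects x, sending x to `ba` detects xx, and sending x, y to `a`, `b` detects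
xy. Conversely, these data decide whether a product vanishes, and a nonzero product depends only on
the set of letters. -/
theorem sat_C3_iff {u v : List ℕ} : Sat C3 u v ↔ Sub2 u v := by
  constructor
  · intro h
    have key : ∀ φ : ℕ → C3, _ := fun φ =>
      (C3.prod_map_eq_z_iff φ u).symm.trans
        ((h φ ▸ Iff.rfl : _ ↔ (v.map φ).prod = C3.z).trans (C3.prod_map_eq_z_iff φ v))
    have hmem : ∀ x, x ∈ u ↔ x ∈ v := by
      intro x
      have hx : ∀ w : List ℕ, (w.map fun c => if c = x then C3.z else C3.e).prod = C3.z ↔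
          x ∈ w := by
        intro w
        rw [C3.prod_map_eq_z_iff]
        constructor
        · rintro (⟨c, hc, h⟩ | ⟨c, d, hcd, h⟩)
          · split_ifs at h with hcx
            exact hcx ▸ hc
          · have hc := hcd.subset (by simp : c ∈ [c, d])
            have hd := hcd.subset (by simp : d ∈ [c, d])
            by_cases hcx : c = x
            · exact hcx ▸ hc
            by_cases hdx : d = x
            · exact hdx ▸ hd
            · rw [if_neg hcx, if_neg hdx] at h
              exact absurd h (by decide)
        · exact fun h => Or.inl ⟨x, h, if_pos rfl⟩
      rw [← hx u, ← hx v, h]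
    refine ⟨hmem, fun x y => ?_⟩
    by_cases hxy : x = y
    · subst hxy
      have hx : ∀ w : List ℕ, (w.map fun c => if c = x then C3.ba else C3.e).prod = C3.z ↔
          [x, x].Sublist w := by
        intro w
        rw [C3.prod_map_eq_z_iff]
        constructor
        · rintro (⟨c, hc, h⟩ | ⟨c, d, hcd, h⟩)
          · split_ifs at h
          · by_cases hcx : c = x <;> by_cases hdx : d = x
            · rwa [hcx, hdx] at hcd
            all_goals
              simp only [hcx, hdx, if_true, if_false] at h
              exact absurd h (by decide)
        · exact fun h => Or.inr ⟨x, x, h, by simp; rfl⟩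
      rw [← hx u, ← hx v, h]
    · have hx : ∀ w : List ℕ,
          (w.map fun c => if c = x then C3.a else if c = y then C3.b else C3.e).prod = C3.z ↔
          [x, y].Sublist w := by
        intro w
        rw [C3.prod_map_eq_z_iff]
        constructor
        · rintro (⟨c, hc, h⟩ | ⟨c, d, hcd, h⟩)
          · split_ifs at h
          · by_cases hcx : c = x <;> by_cases hdy : d = y
            · rwa [hcx, hdy] at hcd
            all_goals
              simp only [hcx, hdy, if_true, if_false] at h
              split_ifs at h <;> exact absurd h (by decide)
        · exact fun h => Or.inr ⟨x, y, h, by simp [Ne.symm hxy]; rfl⟩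
      rw [← hx u, ← hx v, h]
  · rintro ⟨h1, h2⟩ φ
    have hz : (u.map φ).prod = C3.z ↔ (v.map φ).prod = C3.z := by
      rw [C3.prod_map_eq_z_iff, C3.prod_map_eq_z_iff]
      simp only [h1, h2]
    by_cases hu : (u.map φ).prod = C3.z
    · rw [hu, hz.1 hu]
    · have good : ∀ w : List ℕ, (w.map φ).prod ≠ C3.z → C3.z ∉ w.map φ ∧
          ∀ p q, [p, q].Sublist (w.map φ) → p * q ≠ C3.z := by
        intro w hw
        rw [Ne, C3.prod_map_eq_z_iff, not_or] at hw
        push Not at hw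
        refine ⟨by simpa using hw.1, fun p q hpq => ?_⟩
        obtain ⟨l, hl, hm⟩ := List.sublist_map_iff.1 hpq
        match l, hm with
        | [x, y], hm =>
          simp only [List.map_cons, List.map_nil, List.cons.injEq, and_true] at hm
          rw [hm.1, hm.2]
          exact hw.2 x y hl
      have hv : (v.map φ).prod ≠ C3.z := fun k => hu (hz.2 k)
      rw [C3.prod_eq_of_forall_ne (good u hu).1 (good u hu).2,
        C3.prod_eq_of_forall_ne (good v hv).1 (good v hv).2]
      simp only [List.mem_map, h1]

/-- The images of the generators of `A₀` in `C3`. -/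
def A0Gen.toC3 : A0Gen → C3
  | A0Gen.a => C3.a
  | A0Gen.b => C3.b

/-- The homomorphism from the free semigroup with zero to `C3`. -/
def freeToC3 : WithZero (FreeSemigroup A0Gen) →ₙ* C3 where
  toFun := WithZero.recZeroCoe C3.z (FreeSemigroup.lift A0Gen.toC3)
  map_mul' := by
    intro x y
    induction x using WithZero.recZeroCoe with
    | zero =>
      rw [zero_mul]
      exact ((by decide : ∀ g : C3, C3.z = C3.z * g) _)
    | coe x =>
      induction y using WithZero.recZeroCoe with
      | zero =>
        rw [mul_zero]
        exact ((by decide : ∀ g : C3, C3.z = g * C3.z) _)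
      | coe y => exact map_mul (FreeSemigroup.lift A0Gen.toC3) x y

theorem conGen_A0Rel_le : conGen A0Rel ≤ Con.ker freeToC3 := by
  refine Con.conGen_le.2 ?_
  intro x y h
  cases h <;> rfl

/-- The homomorphism from `A₀` to `C3`. -/
def A0.toC3 : A0 →ₙ* C3 where
  toFun q := Con.liftOn q freeToC3 fun _ _ h => conGen_A0Rel_le h
  map_mul' := by
    intro x y
    induction x, y using Con.induction_on₂ with
    | H x y => exact map_mul freeToC3 x y

/-- Prepending a generator to one of the four normal forms gives one of them again. This bound on
the size of `A0` makes the map to `C3` injective. -/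
theorem A0.cases (x : A0) :
    x = (A0Gen.a.toWord : A0) ∨ x = (A0Gen.b.toWord : A0) ∨
      x = (A0Gen.b.toWord : A0) * (A0Gen.a.toWord : A0) ∨
      x = ((0 : WithZero (FreeSemigroup A0Gen)) : A0) := by
  set c := conGen A0Rel
  set α : A0 := (A0Gen.a.toWord : A0)
  set β : A0 := (A0Gen.b.toWord : A0)
  set ζ : A0 := ((0 : WithZero (FreeSemigroup A0Gen)) : A0)
  have haa : α * α = α := (Con.eq c).2 (ConGen.Rel.of _ _ A0Rel.aa)
  have hbb : β * β = β := (Con.eq c).2 (ConGen.Rel.of _ _ A0Rel.bb)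
  have hab : α * β = ζ := (Con.eq c).2 (ConGen.Rel.of _ _ A0Rel.ab)
  have hz : ∀ y : A0, y * ζ = ζ := by
    intro y
    induction y using Con.induction_on with
    | H y => exact congrArg (fun w : WithZero (FreeSemigroup A0Gen) => (w : A0)) (mul_zero y)
  have hz' : ∀ y : A0, ζ * y = ζ := by
    intro y
    induction y using Con.induction_on with
    | H y => exact congrArg (fun w : WithZero (FreeSemigroup A0Gen) => (w : A0)) (zero_mul y)
  induction x using Con.induction_on with
  | H x =>
    induction x using WithZero.recZeroCoe with
    | zero => exact Or.inr (Or.inr (Or.inr rfl))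
    | coe x =>
      induction x using FreeSemigroup.recOnMul with
      | ih1 g =>
        cases g
        · exact Or.inl rfl
        · exact Or.inr (Or.inl rfl)
      | ih2 g y _ hy =>
        have hg : (((FreeSemigroup.of g * y : FreeSemigroup A0Gen) :
            WithZero (FreeSemigroup A0Gen)) : A0) =
            (g.toWord : A0) * ((y : WithZero (FreeSemigroup A0Gen)) : A0) := rfl
        rw [hg]
        rcases hy with hy | hy | hy | hy <;> rw [hy] <;> cases g
        · exact Or.inl haa
        · exact Or.inr (Or.inr (Or.inl rfl))
        · exact Or.inr (Or.inr (Or.inr hab))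
        · exact Or.inr (Or.inl hbb)
        · refine Or.inr (Or.inr (Or.inr ?_))
          rw [← mul_assoc]
          exact (congrArg (· * α) hab).trans (hz' α)
        · refine Or.inr (Or.inr (Or.inl ?_))
          rw [← mul_assoc]
          exact congrArg (· * α) hbb
        · exact Or.inr (Or.inr (Or.inr (hz _)))
        · exact Or.inr (Or.inr (Or.inr (hz _)))

/-- The homomorphism from `A₀¹` to `C3`. -/
def A0One.toC3 : A0One →* C3 := WithOne.lift A0.toC3

theorem A0One.toC3_injective : Function.Injective A0One.toC3 := by
  intro x y h
  induction x using WithOne.recOneCoe with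
  | one =>
    induction y using WithOne.recOneCoe with
    | one => rfl
    | coe y =>
      rcases A0.cases y with rfl | rfl | rfl | rfl <;> exact absurd h (by decide)
  | coe x =>
    induction y using WithOne.recOneCoe with
    | one =>
      rcases A0.cases x with rfl | rfl | rfl | rfl <;> exact absurd h (by decide)
    | coe y =>
      rcases A0.cases x with rfl | rfl | rfl | rfl <;>
      rcases A0.cases y with rfl | rfl | rfl | rfl <;>
      first | rfl | exact absurd h (by decide)

theorem A0One.toC3_surjective : Function.Surjective A0One.toC3 := by
  intro x
  cases x
  · exact ⟨1, rfl⟩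
  · exact ⟨((A0Gen.a.toWord : A0) : A0One), rfl⟩
  · exact ⟨((A0Gen.b.toWord : A0) : A0One), rfl⟩
  · exact ⟨((A0Gen.b.toWord * A0Gen.a.toWord : A0) : A0One), rfl⟩
  · exact ⟨(((0 : WithZero (FreeSemigroup A0Gen)) : A0) : A0One), rfl⟩

theorem sat_A0One_iff {u v : List ℕ} : Sat A0One u v ↔ Sub2 u v :=
  (sat_iff_of_injective A0One.toC3 A0One.toC3_injective A0One.toC3_surjective).trans sat_C3_iff

/-! ### A finite basis of A₀¹ -/

theorem pair_sublist_cons {x y c : ℕ} {l : List ℕ} :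
    [x, y].Sublist (c :: l) ↔ (x = c ∧ y ∈ l) ∨ [x, y].Sublist l := by
  constructor
  · intro h
    cases h with
    | cons _ h => exact Or.inr h
    | cons_cons _ h => exact Or.inl ⟨rfl, List.singleton_sublist.1 h⟩
  · rintro (⟨rfl, h⟩ | h)
    · exact List.Sublist.cons_cons _ (List.singleton_sublist.2 h)
    · exact h.cons _

theorem pair_sublist_append {x y : ℕ} {p q : List ℕ} :
    [x, y].Sublist (p ++ q) ↔ [x, y].Sublist p ∨ (x ∈ p ∧ y ∈ q) ∨ [x, y].Sublist q := by
  induction p with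
  | nil => simp
  | cons c p ih =>
    rw [List.cons_append, pair_sublist_cons, pair_sublist_cons, ih, List.mem_append,
      List.mem_cons]
    tauto

theorem mem_of_pair_sublist {x y : ℕ} {l : List ℕ} (h : [x, y].Sublist l) : x ∈ l ∧ y ∈ l :=
  ⟨h.subset (by simp), h.subset (by simp)⟩

/-- Restricts the quantifiers to letters of `u`, so that `decide` can check explicit identities. -/
theorem sub2_of_forall_mem {u v : List ℕ} (h1 : ∀ x ∈ u, x ∈ v) (h2 : ∀ x ∈ v, x ∈ u)
    (h3 : ∀ x ∈ u, ∀ y ∈ u, [x, y].Sublist u ↔ [x, y].Sublist v) : Sub2 u v := by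
  refine ⟨fun x => ⟨h1 x, h2 x⟩, fun x y => ?_⟩
  by_cases h : x ∈ u ∧ y ∈ u
  · exact h3 x h.1 y h.2
  · refine iff_of_false (fun k => h (mem_of_pair_sublist k)) fun k => h ?_
    exact ⟨h2 x (mem_of_pair_sublist k).1, h2 y (mem_of_pair_sublist k).2⟩

/-- The finite basis of `A₀¹`. -/
abbrev basisA0One : Set Identity := boundedIdentities A0One 8

theorem derives_basisA0One {u v : List ℕ} (h1 : ∀ x ∈ u, x ∈ v) (h2 : ∀ x ∈ v, x ∈ u)
    (h3 : ∀ x ∈ u, ∀ y ∈ u, [x, y].Sublist u ↔ [x, y].Sublist v)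
    (hu : u.length ≤ 8 ∧ ∀ x ∈ u, x < 8) (hv : v.length ≤ 8 ∧ ∀ x ∈ v, x < 8)
    (θ : ℕ → List ℕ) : Derives basisA0One (u.flatMap θ) (v.flatMap θ) :=
  derives_subst (sat_A0One_iff.2 (sub2_of_forall_mem h1 h2 h3)) (fun x => ⟨h1 x, h2 x⟩) hu hv θ

theorem derives_delete {p q : List ℕ} {x : ℕ} (hp : x ∈ p) (hq : x ∈ q) :
    Derives basisA0One (p ++ x :: q) (p ++ q) := by
  obtain ⟨p1, p2, rfl⟩ := List.append_of_mem hp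
  obtain ⟨q1, q2, rfl⟩ := List.append_of_mem hq
  have := derives_basisA0One (u := [0, 1, 0, 2, 0]) (v := [0, 1, 2, 0]) (by decide) (by decide)
    (by decide) (by decide) (by decide) (fun n => if n = 0 then [x] else if n = 1 then p2 else q1)
  simpa using this.context p1 q2

/-- Both xy and yx already occur as scattered subwords thanks to the earlier copies in `p`. Two
short identities are needed, one for each order of those copies. -/
theorem derives_swap_right {p q : List ℕ} {x y : ℕ} (hx : x ∈ p) (hy : y ∈ p) :
    Derives basisA0One (p ++ x :: y :: q) (p ++ y :: x :: q) := by
  by_cases hxy : x = y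
  · exact Derives.of_eq (by rw [hxy])
  obtain ⟨p1, p2, rfl⟩ := List.append_of_mem hx
  rcases List.mem_append.1 hy with hy | hy
  · obtain ⟨p0, p1, rfl⟩ := List.append_of_mem hy
    have := derives_basisA0One (u := [1, 2, 0, 3, 0, 1]) (v := [1, 2, 0, 3, 1, 0]) (by decide)
      (by decide) (by decide) (by decide) (by decide)
      (fun n => if n = 0 then [x] else if n = 1 then [y] else if n = 2 then p1 else p2)
    simpa using this.context p0 q
  · rcases List.mem_cons.1 hy with hy | hy
    · exact absurd hy.symm hxy
    obtain ⟨p2, p3, rfl⟩ := List.append_of_mem hy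
    have := derives_basisA0One (u := [0, 2, 1, 3, 0, 1]) (v := [0, 2, 1, 3, 1, 0]) (by decide)
      (by decide) (by decide) (by decide) (by decide)
      (fun n => if n = 0 then [x] else if n = 1 then [y] else if n = 2 then p2 else p3)
    simpa using this.context p1 q

theorem derives_swap_left {p q : List ℕ} {x y : ℕ} (hx : x ∈ q) (hy : y ∈ q) :
    Derives basisA0One (p ++ x :: y :: q) (p ++ y :: x :: q) := by
  by_cases hxy : x = y
  · exact Derives.of_eq (by rw [hxy])
  obtain ⟨p1, p2, rfl⟩ := List.append_of_mem hx
  rcases List.mem_append.1 hy with hy | hy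
  · obtain ⟨p0, p1, rfl⟩ := List.append_of_mem hy
    have := derives_basisA0One (u := [0, 1, 2, 1, 3, 0]) (v := [1, 0, 2, 1, 3, 0]) (by decide)
      (by decide) (by decide) (by decide) (by decide)
      (fun n => if n = 0 then [x] else if n = 1 then [y] else if n = 2 then p0 else p1)
    simpa using this.context p p2
  · rcases List.mem_cons.1 hy with hy | hy
    · exact absurd hy.symm hxy
    obtain ⟨p2, p3, rfl⟩ := List.append_of_mem hy
    have := derives_basisA0One (u := [0, 1, 2, 0, 3, 1]) (v := [1, 0, 2, 0, 3, 1]) (by decide)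
      (by decide) (by decide) (by decide) (by decide)
      (fun n => if n = 0 then [x] else if n = 1 then [y] else if n = 2 then p1 else p2)
    simpa using this.context p p3

theorem derives_move_right {r p q : List ℕ} {x : ℕ} (hx : x ∈ p) (hr : ∀ c ∈ r, c ∈ p) :
    Derives basisA0One (p ++ x :: r ++ q) (p ++ r ++ x :: q) := by
  induction r generalizing p with
  | nil => exact Derives.of_eq (by simp)
  | cons c r ih =>
    have h1 : Derives basisA0One (p ++ x :: c :: (r ++ q)) (p ++ c :: x :: (r ++ q)) :=
      derives_swap_right hx (hr c (by simp))
    have h2 := ih (p := p ++ [c]) (List.mem_append_left _ hx)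
      fun d hd => List.mem_append_left _ (hr d (List.mem_cons_of_mem _ hd))
    simp only [List.append_assoc, List.cons_append, List.nil_append] at h1 h2 ⊢
    exact h1.trans h2

theorem derives_move_left {r p q : List ℕ} {x : ℕ} (hx : x ∈ q) (hr : ∀ c ∈ r, c ∈ q) :
    Derives basisA0One (p ++ r ++ x :: q) (p ++ x :: r ++ q) := by
  induction r generalizing p with
  | nil => exact Derives.of_eq (by simp)
  | cons c r ih =>
    have h1 : Derives basisA0One (p ++ c :: x :: (r ++ q)) (p ++ x :: c :: (r ++ q)) :=
      derives_swap_left (List.mem_append_right _ (hr c (by simp))) (List.mem_append_right _ hx)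
    have h2 := ih (p := p ++ [c]) fun d hd => hr d (List.mem_cons_of_mem _ hd)
    simp only [List.append_assoc, List.cons_append, List.nil_append] at h1 h2 ⊢
    exact h2.trans h1

theorem exists_last_occurrence {x : ℕ} {p : List ℕ} (h : x ∈ p) :
    ∃ p1 p2, p = p1 ++ x :: p2 ∧ x ∉ p2 := by
  obtain ⟨r, s, h1, h2⟩ := List.eq_append_cons_of_mem (List.mem_reverse.2 h)
  refine ⟨s.reverse, r.reverse, ?_, by simpa using h2⟩
  have := congrArg List.reverse h1
  simpa using this

/-- If x occurs on both sides, the new x is an inner occurrence. If it occurs only in `p`, every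
letter c of `p` must precede some x in `p`, hence occurs before the last x. So the last x can be
doubled and the copy moved right to its place. The remaining case is the mirror image. -/
theorem derives_insert {p q : List ℕ} {x : ℕ} (h : Sub2 (p ++ q) (p ++ x :: q)) :
    Derives basisA0One (p ++ q) (p ++ x :: q) := by
  obtain ⟨h1, h2⟩ := h
  have hpq : x ∈ p ++ q := (h1 x).2 (by simp)
  have hxx : ∀ c ∈ p, [c, x].Sublist (p ++ q) := fun c hc =>
    (h2 c x).2 (pair_sublist_append.2 (Or.inr (Or.inl ⟨hc, by simp⟩)))
  have hxx' : ∀ c ∈ q, [x, c].Sublist (p ++ q) := fun c hc =>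
    (h2 x c).2 (pair_sublist_append.2 (Or.inr (Or.inr (pair_sublist_cons.2 (Or.inl ⟨rfl, hc⟩)))))
  by_cases hp : x ∈ p
  · by_cases hq : x ∈ q
    · exact (derives_delete hp hq).symm
    · have hin : ∀ c ∈ p, [c, x].Sublist p := by
        intro c hc
        rcases pair_sublist_append.1 (hxx c hc) with h | h | h
        · exact h
        · exact absurd h.2 hq
        · exact absurd (mem_of_pair_sublist h).2 hq
      obtain ⟨p1, p2, rfl, hp2⟩ := exists_last_occurrence hp
      have hin' : ∀ c ∈ p1 ++ x :: p2, c ∈ p1 := by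
        intro c hc
        rcases pair_sublist_append.1 (hin c hc) with h | h | h
        · exact (mem_of_pair_sublist h).1
        · exact h.1
        · rcases pair_sublist_cons.1 h with h | h
          · exact absurd h.2 hp2
          · exact absurd (mem_of_pair_sublist h).2 hp2
      have hx1 : x ∈ p1 := hin' x hp
      have s1 : Derives basisA0One (p1 ++ x :: x :: (p2 ++ q)) (p1 ++ x :: (p2 ++ q)) :=
        derives_delete hx1 (by simp)
      have s2 := derives_move_right (r := p2) (p := p1 ++ [x]) (q := q) (x := x) (by simp)
        fun c hc => List.mem_append_left _ (hin' c (by simp [hc]))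
      simp only [List.append_assoc, List.cons_append, List.nil_append] at s1 s2 ⊢
      exact s1.symm.trans s2
  · have hq : x ∈ q := (List.mem_append.1 hpq).resolve_left hp
    have hin : ∀ c ∈ q, [x, c].Sublist q := by
      intro c hc
      rcases pair_sublist_append.1 (hxx' c hc) with h | h | h
      · exact absurd (mem_of_pair_sublist h).1 hp
      · exact absurd h.1 hp
      · exact h
    obtain ⟨q1, q2, rfl, hq1⟩ := List.eq_append_cons_of_mem hq
    have hin' : ∀ c ∈ q1 ++ x :: q2, c ∈ q2 := by
      intro c hc
      rcases pair_sublist_append.1 (hin c hc) with h | h | h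
      · exact absurd (mem_of_pair_sublist h).1 hq1
      · exact absurd h.1 hq1
      · rcases pair_sublist_cons.1 h with h | h
        · exact h.2
        · exact (mem_of_pair_sublist h).2
    have hx2 : x ∈ q2 := hin' x hq
    have s1 : Derives basisA0One ((p ++ q1 ++ [x]) ++ x :: q2) ((p ++ q1 ++ [x]) ++ q2) :=
      derives_delete (by simp) hx2
    have s2 := derives_move_left (r := q1) (p := p) (q := x :: q2) (x := x) (by simp)
      fun c hc => List.mem_cons_of_mem _ (hin' c (by simp [hc]))
    simp only [List.append_assoc, List.cons_append, List.nil_append] at s1 s2 ⊢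
    exact s1.symm.trans s2

theorem Sub2.symm {u v : List ℕ} (h : Sub2 u v) : Sub2 v u :=
  ⟨fun x => (h.1 x).symm, fun x y => (h.2 x y).symm⟩

theorem Sub2.trans {u v w : List ℕ} (h : Sub2 u v) (k : Sub2 v w) : Sub2 u w :=
  ⟨fun x => (h.1 x).trans (k.1 x), fun x y => (h.2 x y).trans (k.2 x y)⟩

theorem sub2_of_sublist {u v w : List ℕ} (h : Sub2 u w) (huv : u.Sublist v)
    (hvw : v.Sublist w) : Sub2 u v :=
  ⟨fun x => ⟨fun k => huv.subset k, fun k => (h.1 x).2 (hvw.subset k)⟩,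
    fun x y => ⟨fun k => k.trans huv, fun k => (h.2 x y).2 (k.trans hvw)⟩⟩

theorem derives_of_sublist_append {s r p : List ℕ} (hs : s.Sublist r)
    (h : Sub2 (p ++ s) (p ++ r)) : Derives basisA0One (p ++ s) (p ++ r) := by
  induction hs generalizing p with
  | slnil => exact Derives.refl _
  | @cons s r c hs ih =>
    have hsub : Sub2 (p ++ s) (p ++ c :: s) :=
      sub2_of_sublist h ((List.sublist_cons_self c s).append_left p)
        ((hs.cons_cons c).append_left p)
    have := ih (p := p ++ [c])
      (by simpa using hsub.symm.trans h)
    exact (derives_insert hsub).trans (by simpa using this)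
  | @cons_cons s r c hs ih =>
    have := ih (p := p ++ [c]) (by simpa using h)
    simpa using this

/-- Failure of the second alternative gives a ∉ p. If the first fails at c, then a (when c = a) or
ac is a scattered subword of the left word, hence of the right one. There it lies inside r, so bc is
a subword too, a contradiction. -/
theorem sub2_insert_or {p s r : List ℕ} {a b : ℕ} (hab : a ≠ b)
    (h : Sub2 (p ++ a :: s) (p ++ b :: r)) :
    (∀ c ∈ a :: s, [b, c].Sublist (p ++ a :: s)) ∨ ∀ c ∈ b :: r, [a, c].Sublist (p ++ b :: r) := by
  by_contra hcon
  push Not at hcon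
  obtain ⟨⟨c, hc, hbc⟩, d, hd, had⟩ := hcon
  have hbc' := (h.2 b c).not.1 hbc
  have had' := (h.2 a d).not.2 had
  have h1 := h.1 b
  have h2 := h.1 a
  have h3 := h.2 a c
  have h4 := h.2 b d
  simp only [pair_sublist_append, pair_sublist_cons, List.mem_append, List.mem_cons] at *
  have h5 : [a, d].Sublist p → a ∈ p := fun k => (mem_of_pair_sublist k).1
  have h6 : [b, c].Sublist p → b ∈ p := fun k => (mem_of_pair_sublist k).1
  have h7 : [b, d].Sublist p → b ∈ p := fun k => (mem_of_pair_sublist k).1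
  have h8 : [a, c].Sublist p → a ∈ p := fun k => (mem_of_pair_sublist k).1
  have h9 : [a, c].Sublist r → c ∈ r := fun k => (mem_of_pair_sublist k).2
  have h10 : [b, d].Sublist s → d ∈ s := fun k => (mem_of_pair_sublist k).2
  have hba := hab.symm
  grind

theorem sub2_insert {p s r : List ℕ} {a b : ℕ} (h : Sub2 (p ++ a :: s) (p ++ b :: r))
    (hb : ∀ c ∈ a :: s, [b, c].Sublist (p ++ a :: s)) :
    Sub2 (p ++ a :: s) (p ++ b :: a :: s) := by
  refine ⟨fun x => ?_, fun x y => ?_⟩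
  · have := h.1 b
    simp only [List.mem_append, List.mem_cons] at this ⊢
    by_cases hx : x = b
    · subst hx
      tauto
    · tauto
  · refine ⟨fun k => k.trans ((List.sublist_cons_self b _).append_left p), fun k => ?_⟩
    rcases pair_sublist_append.1 k with k | ⟨k1, k2⟩ | k
    · exact pair_sublist_append.2 (Or.inl k)
    · rcases List.mem_cons.1 k2 with rfl | k2
      · exact (h.2 _ _).2 (pair_sublist_append.2 (Or.inr (Or.inl ⟨k1, by simp⟩)))
      · exact pair_sublist_append.2 (Or.inr (Or.inl ⟨k1, k2⟩))
    · rcases pair_sublist_cons.1 k with ⟨rfl, k'⟩ | k'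
      · exact hb y k'
      · exact pair_sublist_append.2 (Or.inr (Or.inr k'))

/-- The induction is on the total length of the unmatched suffixes: an insertion leaves one suffix
unchanged and removes the first letter of the other. -/
theorem derives_of_sub2_append (n : ℕ) : ∀ p s r : List ℕ, s.length + r.length ≤ n →
    Sub2 (p ++ s) (p ++ r) → Derives basisA0One (p ++ s) (p ++ r) := by
  induction n with
  | zero =>
    intro p s r hn h
    obtain rfl := List.length_eq_zero_iff.1 (by omega : s.length = 0)
    obtain rfl := List.length_eq_zero_iff.1 (by omega : r.length = 0)
    exact Derives.refl _
  | succ n ih =>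
    intro p s r hn h
    match s, r with
    | [], r => exact derives_of_sublist_append (List.nil_sublist r) h
    | s, [] => exact (derives_of_sublist_append (List.nil_sublist s) h.symm).symm
    | a :: s, b :: r =>
      simp only [List.length_cons] at hn
      by_cases hab : a = b
      · subst hab
        have := ih (p ++ [a]) s r (by omega) (by simpa using h)
        simpa using this
      · rcases sub2_insert_or hab h with hb | ha
        · have k := sub2_insert h hb
          have := ih (p ++ [b]) (a :: s) r (by simp; omega) (by simpa using k.symm.trans h)
          exact (derives_insert k).trans (by simpa using this)
        · have k := sub2_insert h.symm ha
          have := ih (p ++ [a]) s (b :: r) (by simp; omega) (by simpa using h.trans k)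
          exact Derives.trans (by simpa using this) (derives_insert k).symm

theorem finitelyBased_A0One : FinitelyBased A0One :=
  finitelyBased_of_derives 8 fun u v h =>
    derives_of_sub2_append _ [] u v le_rfl (sat_A0One_iff.1 h)

/-! ### Evaluations in S(W_i) and what they detect -/

/-- `w` is a block of consecutive letters of some `a^(i+1-d) t a^d` with `0 < d < i + 1`. -/
def IsBlock (a t i : ℕ) (w : List ℕ) : Prop :=
  ∃ d p q, 0 < d ∧ d < i + 1 ∧
    List.replicate (i + 1 - d) a ++ t :: List.replicate d a = p ++ w ++ q

theorem toList_pow_of (a : ℕ) (n : ℕ) :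
    FreeMonoid.toList (FreeMonoid.of a ^ n) = List.replicate n a := by
  induction n with
  | zero => rfl
  | succ n ih =>
    rw [pow_succ, FreeMonoid.toList_mul, ih, FreeMonoid.toList_of, List.replicate_succ']

theorem isSubwordOf_wordSet_iff {a t i : ℕ} {w : List ℕ} :
    IsSubwordOf (wordSet a t i) (FreeMonoid.ofList w) ↔ IsBlock a t i w := by
  have hw : ∀ d, FreeMonoid.toList (FreeMonoid.of a ^ (i + 1 - d) * FreeMonoid.of t *
      FreeMonoid.of a ^ d) = List.replicate (i + 1 - d) a ++ t :: List.replicate d a := by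
    intro d
    rw [FreeMonoid.toList_mul, FreeMonoid.toList_mul, toList_pow_of, toList_pow_of,
      FreeMonoid.toList_of, List.append_assoc, List.singleton_append]
  constructor
  · rintro ⟨w', ⟨d, h0, h1, rfl⟩, p, q, h⟩
    refine ⟨d, p.toList, q.toList, h0, h1, ?_⟩
    rw [← hw, h]
    rfl
  · rintro ⟨d, p, q, h0, h1, h⟩
    refine ⟨_, ⟨d, h0, h1, rfl⟩, FreeMonoid.ofList p, FreeMonoid.ofList q, ?_⟩
    apply FreeMonoid.toList.injective
    rw [hw, h]
    rfl

theorem sat_SMonoid_iff {a t i : ℕ} {u v : List ℕ} :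
    Sat (SMonoid (wordSet a t i)) u v ↔ ∀ θ : ℕ → List ℕ,
      u.flatMap θ = v.flatMap θ ∨
        (¬ IsBlock a t i (u.flatMap θ) ∧ ¬ IsBlock a t i (v.flatMap θ)) := by
  have hprod : ∀ (θ : ℕ → List ℕ) (w : List ℕ),
      (w.map fun x => ((FreeMonoid.ofList (θ x) : FreeMonoid ℕ) :
        SMonoid (wordSet a t i))).prod =
      ((FreeMonoid.ofList (w.flatMap θ) : FreeMonoid ℕ) : SMonoid (wordSet a t i)) := by
    intro θ w
    induction w with
    | nil => rfl
    | cons x w ih => rw [List.map_cons, List.prod_cons, ih]; rfl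
  have hrel : ∀ w w' : List ℕ, ((FreeMonoid.ofList w : FreeMonoid ℕ) :
      SMonoid (wordSet a t i)) = ((FreeMonoid.ofList w' : FreeMonoid ℕ) :
        SMonoid (wordSet a t i)) ↔ w = w' ∨ (¬ IsBlock a t i w ∧ ¬ IsBlock a t i w') := by
    intro w w'
    rw [← isSubwordOf_wordSet_iff, ← isSubwordOf_wordSet_iff]
    exact Con.eq (reesCon (wordSet a t i))
  constructor
  · intro h θ
    rw [← hrel, ← hprod, ← hprod]
    exact h _
  · intro h φ
    have hex : ∀ x, ∃ w : List ℕ, ((FreeMonoid.ofList w : FreeMonoid ℕ) :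
        SMonoid (wordSet a t i)) = φ x := by
      intro x
      obtain ⟨w, hw⟩ := Con.mk'_surjective (φ x)
      exact ⟨w.toList, hw⟩
    choose θ hθ using hex
    have := (hrel _ _).2 (h θ)
    rw [← hprod, ← hprod] at this
    simpa only [hθ] using this

/-- A block avoiding the letter `s` lies on one side of any occurrence of `s`. -/
theorem block_of_not_mem {s : ℕ} {X Y c G d : List ℕ} (h : X ++ s :: Y = c ++ G ++ d)
    (hs : s ∉ G) : (∃ e, X = c ++ G ++ e ∧ d = e ++ s :: Y) ∨
      ∃ e, Y = e ++ G ++ d ∧ c = X ++ s :: e := by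
  rw [List.append_eq_append_iff] at h
  rcases h with ⟨e, h1, h2⟩ | ⟨e, h1, h2⟩
  · rcases e with _ | ⟨e, es⟩
    · left
      exact ⟨[], by simpa using h1.symm, by simpa using h2.symm⟩
    · simp only [List.cons_append, List.cons.injEq] at h2
      obtain ⟨rfl, h2⟩ := h2
      rw [List.append_eq_append_iff] at h1
      rcases h1 with ⟨f, h3, h4⟩ | ⟨f, h3, h4⟩
      · exact absurd (h4 ▸ List.mem_append_right f (List.mem_cons_self)) hs
      · rcases f with _ | ⟨f, fs⟩
        · simp only [List.nil_append] at h4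
          exact absurd (h4 ▸ List.mem_cons_self) hs
        · simp only [List.cons_append, List.cons.injEq] at h4
          obtain ⟨rfl, rfl⟩ := h4
          exact Or.inr ⟨fs, h2, h3⟩
  · exact Or.inl ⟨e, h1, h2⟩

section Block

variable {a t i : ℕ}

theorem IsBlock.count_le {w : List ℕ} (hat : a ≠ t) (h : IsBlock a t i w) :
    w.count a ≤ i + 1 := by
  obtain ⟨d, p, q, h0, h1, h⟩ := h
  have := congrArg (List.count a) h
  simp [hat.symm] at this
  omega

theorem IsBlock.count_le_one {w : List ℕ} (h : IsBlock a t i w) {c : ℕ} (hc : c ≠ a) :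
    w.count c ≤ 1 := by
  obtain ⟨d, p, q, h0, h1, h⟩ := h
  have := congrArg (List.count c) h
  simp [List.count_cons, List.count_replicate, hc.symm] at this
  split_ifs at this <;> omega

/-- Since 0 < d < i + 1, each side of t holds at most i letters a. -/
theorem not_isBlock_replicate (hat : a ≠ t) (p q : List ℕ) :
    ¬ IsBlock a t i (p ++ List.replicate (i + 1) a ++ q) := by
  rintro ⟨d, p', q', h0, h1, h⟩
  have h' : List.replicate (i + 1 - d) a ++ t :: List.replicate d a =
      (p' ++ p) ++ List.replicate (i + 1) a ++ (q ++ q') := by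
    rw [h]
    simp
  rcases block_of_not_mem h' (by simp [hat.symm]) with ⟨e, h, _⟩ | ⟨e, h, _⟩
  · have := congrArg List.length h
    simp at this
    omega
  · have := congrArg List.length h
    simp at this
    omega

theorem isBlock_replicate {k : ℕ} (hi : 1 ≤ i) (hk : k ≤ i) :
    IsBlock a t i (List.replicate k a) := by
  refine ⟨1, List.replicate (i - k) a, t :: List.replicate 1 a, one_pos, by omega, ?_⟩
  rw [← List.replicate_add, Nat.sub_add_cancel hk, Nat.add_sub_cancel]

theorem isBlock_replicate_cons {k l : ℕ} (hi : 1 ≤ i) (hk : k ≤ i) (hl : l ≤ i)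
    (hkl : k + l ≤ i + 1) :
    IsBlock a t i (List.replicate k a ++ t :: List.replicate l a) := by
  have key : ∀ d, 0 < d → d < i + 1 → k ≤ i + 1 - d → l ≤ d →
      IsBlock a t i (List.replicate k a ++ t :: List.replicate l a) := by
    intro d h0 h1 h2 h3
    refine ⟨d, List.replicate (i + 1 - d - k) a, List.replicate (d - l) a, h0, h1, ?_⟩
    rw [← List.append_assoc, ← List.replicate_add, Nat.sub_add_cancel h2, List.append_assoc,
      List.cons_append, ← List.replicate_add, Nat.add_sub_cancel' h3]
  rcases Nat.eq_zero_or_pos l with rfl | h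
  · exact key 1 one_pos (by omega) (by omega) (by omega)
  · exact key l h (by omega) (by omega) le_rfl

end Block

theorem flatMap_ite_replicate (a x : ℕ) (u : List ℕ) :
    (u.flatMap fun c => if c = x then [a] else []) = List.replicate (u.count x) a := by
  induction u with
  | nil => rfl
  | cons c u ih =>
    by_cases h : c = x
    · simp [h, ih, List.replicate_succ]
    · simp [h, ih]

theorem exists_linear_split {s : ℕ} {u : List ℕ} (h : u.count s = 1) :
    ∃ p q, u = p ++ s :: q ∧ s ∉ p ∧ s ∉ q := by
  obtain ⟨p, q, rfl, hp⟩ :=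
    List.eq_append_cons_of_mem (List.count_pos_iff.1 (by omega : 0 < u.count s))
  refine ⟨p, q, rfl, hp, fun hq => ?_⟩
  have := List.count_pos_iff.2 hq
  simp at h
  omega

theorem filter_eq_replicate {x : ℕ} {p : List ℕ} :
    p.filter (fun c => decide (c = x)) = List.replicate (p.count x) x := by
  induction p with
  | nil => rfl
  | cons c u ih =>
    by_cases h : c = x
    · simp [h, ih, List.replicate_succ]
    · simp [h, ih]

/-- The word obtained from `u` by deleting all letters except `x` and `s`. -/
abbrev restrict (x s : ℕ) (u : List ℕ) : List ℕ := u.filter fun c => decide (c = x ∨ c = s)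

theorem restrict_eq_replicate {x s : ℕ} {p : List ℕ} (h : s ∉ p) :
    restrict x s p = List.replicate (p.count x) x := by
  rw [← filter_eq_replicate]
  refine List.filter_congr fun c hc => ?_
  have : c ≠ s := fun k => h (k ▸ hc)
  simp [this]

theorem restrict_split {x s : ℕ} {p q : List ℕ} (hp : s ∉ p) (hq : s ∉ q) :
    restrict x s (p ++ s :: q) =
      List.replicate (p.count x) x ++ s :: List.replicate (q.count x) x := by
  rw [restrict, List.filter_append, List.filter_cons_of_pos (by simp)]
  exact congrArg₂ _ (restrict_eq_replicate hp) (congrArg _ (restrict_eq_replicate hq))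

theorem flatMap_ite_ite (a t x s : ℕ) (u : List ℕ) :
    (u.flatMap fun c => if c = x then [a] else if c = s then [t] else []) =
      (restrict x s u).map fun c => if c = x then a else t := by
  induction u with
  | nil => rfl
  | cons c u ih =>
    by_cases h : c = x
    · simp [restrict, h, ih]
    · by_cases h' : c = s
      · subst h'
        simp [restrict, h, ih]
      · simp [restrict, h, h', ih]

theorem restrict_eq_of_map_eq {a t x s : ℕ} (hat : a ≠ t) {u v : List ℕ}
    (h : (restrict x s u).map (fun c => if c = x then a else t) =
      (restrict x s v).map fun c => if c = x then a else t) :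
    restrict x s u = restrict x s v := by
  have hback : ∀ w : List ℕ, ((restrict x s w).map fun c => if c = x then a else t).map
      (fun c => if c = a then x else s) = restrict x s w := by
    intro w
    rw [List.map_map]
    refine (List.map_congr_left (g := id) fun c hc => ?_).trans (List.map_id _)
    have hc' := (List.mem_filter.1 hc).2
    by_cases hcx : c = x
    · simp [hcx]
    · have : c = s := by simpa [hcx] using hc'
      simp [hat.symm, this]
      exact fun k => absurd (this.trans k) hcx
  rw [← hback u, ← hback v, h]

section SMonoid

variable {a t i : ℕ} {u v : List ℕ}

/-- Evaluate x at a and all other letters at 1; the powers of a up to exponent i are nonzero. -/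
theorem count_eq_of_sat (hi : 1 ≤ i) (h : Sat (SMonoid (wordSet a t i)) u v) {x : ℕ}
    (hx : u.count x ≤ i) : v.count x = u.count x := by
  have := sat_SMonoid_iff.1 h fun c => if c = x then [a] else []
  rw [flatMap_ite_replicate, flatMap_ite_replicate] at this
  rcases this with this | this
  · simpa using (congrArg List.length this).symm
  · exact absurd (isBlock_replicate hi hx) this.1

/-- Evaluate x at a, s at t and the rest at 1. The value a^k t a^l is nonzero: k and l are at most
i, either by the total count or because x occurs on both sides of s. -/
theorem restrict_eq_of_sat (hat : a ≠ t) (hi : 1 ≤ i)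
    (h : Sat (SMonoid (wordSet a t i)) u v) {x s : ℕ} (hxs : x ≠ s) (hs : u.count s = 1)
    (hx : u.count x ≤ i + 1) (hc : u.count x ≤ i ∨ ([x, s].Sublist u ∧ [s, x].Sublist u)) :
    restrict x s u = restrict x s v := by
  have := sat_SMonoid_iff.1 h fun c => if c = x then [a] else if c = s then [t] else []
  rw [flatMap_ite_ite, flatMap_ite_ite] at this
  refine restrict_eq_of_map_eq hat (this.resolve_right fun k => k.1 ?_)
  obtain ⟨p, q, rfl, hp, hq⟩ := exists_linear_split hs
  rw [restrict_split hp hq]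
  simp only [List.map_append, List.map_cons, List.map_replicate, if_true, if_neg hxs.symm]
  simp only [List.count_append, List.count_cons_of_ne hxs.symm] at hx hc
  refine isBlock_replicate_cons hi ?_ ?_ hx
  all_goals
    rcases hc with hc | ⟨h1, h2⟩
    · omega
    · simp only [pair_sublist_append, pair_sublist_cons, List.mem_cons] at h1 h2
      have hqx : 0 < q.count x := by
        rw [List.count_pos_iff]
        rcases h2 with h2 | h2 | h2 | h2
        · exact absurd (mem_of_pair_sublist h2).1 hp
        · exact absurd h2.1 hp
        · exact h2.2
        · exact (mem_of_pair_sublist h2).2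
      have hpx : 0 < p.count x := by
        rw [List.count_pos_iff]
        rcases h1 with h1 | h1 | h1 | h1
        · exact absurd (mem_of_pair_sublist h1).2 hp
        · exact h1.1
        · exact absurd h1.1 hxs
        · exact absurd (mem_of_pair_sublist h1).2 hq
      omega

end SMonoid

/-! ### A finite basis of S(W_i): swaps and free letters -/

theorem count_mul_count_le (θ : ℕ → List ℕ) (x c : ℕ) (w : List ℕ) :
    w.count x * (θ x).count c ≤ (w.flatMap θ).count c := by
  induction w with
  | nil => simp
  | cons y w ih =>
    rw [List.flatMap_cons, List.count_append, List.count_cons]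
    by_cases h : y = x
    · subst h
      simp only [beq_self_eq_true, if_true, add_mul, one_mul]
      omega
    · simp only [beq_eq_false_iff_ne.2 h, Bool.false_eq_true, if_false, add_zero]
      omega

theorem count_le_count_flatMap {θ : ℕ → List ℕ} {x c : ℕ} (h : c ∈ θ x) (w : List ℕ) :
    w.count x ≤ (w.flatMap θ).count c :=
  (Nat.le_mul_of_pos_right _ (List.count_pos_iff.2 h)).trans (count_mul_count_le θ x c w)

section

variable {a t i : ℕ}

/-- Both letters occur at least twice, so a nonzero value forces both images to be powers of a, and
these commute. -/
theorem sat_swap {p q : List ℕ} {x y : ℕ} (hx : x ∈ p ++ q) (hy : y ∈ p ++ q) :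
    Sat (SMonoid (wordSet a t i)) (p ++ x :: y :: q) (p ++ y :: x :: q) := by
  rw [sat_SMonoid_iff]
  intro θ
  have hperm : (p ++ x :: y :: q).Perm (x :: y :: (p ++ q)) :=
    List.perm_middle.trans ((List.perm_middle (a := y) (l₁ := p) (l₂ := q)).cons x)
  have hperm' : (p ++ y :: x :: q).Perm (p ++ x :: y :: q) :=
    (List.Perm.swap x y q).append_left p
  have hx' : 2 ≤ (p ++ x :: y :: q).count x := by
    have := List.count_pos_iff.2 hx
    rw [hperm.count_eq, List.count_cons_self, List.count_cons]
    omega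
  have hy' : 2 ≤ (p ++ x :: y :: q).count y := by
    have := List.count_pos_iff.2 hy
    rw [hperm.count_eq, List.count_cons, List.count_cons_self]
    omega
  have key : ∀ c, c ≠ a → ∀ z, 2 ≤ (p ++ x :: y :: q).count z → c ∈ θ z →
      ¬ IsBlock a t i ((p ++ x :: y :: q).flatMap θ) ∧
        ¬ IsBlock a t i ((p ++ y :: x :: q).flatMap θ) := by
    intro c hc z hz hcz
    constructor
    · intro h
      have h1 := h.count_le_one hc
      have h2 := count_le_count_flatMap hcz (p ++ x :: y :: q)
      omega
    · intro h
      have h1 := h.count_le_one hc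
      have h2 := count_le_count_flatMap hcz (p ++ y :: x :: q)
      rw [hperm'.count_eq] at h2
      omega
  by_cases h1 : ∃ c ∈ θ x, c ≠ a
  · obtain ⟨c, hc, hca⟩ := h1
    exact Or.inr (key c hca x hx' hc)
  by_cases h2 : ∃ c ∈ θ y, c ≠ a
  · obtain ⟨c, hc, hca⟩ := h2
    exact Or.inr (key c hca y hy' hc)
  push Not at h1 h2
  left
  have hcomm : θ x ++ θ y = θ y ++ θ x := by
    rw [List.eq_replicate_of_mem h1, List.eq_replicate_of_mem h2, ← List.replicate_add,
      ← List.replicate_add, add_comm]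
  simp only [List.flatMap_append, List.flatMap_cons]
  rw [← List.append_assoc (θ x), hcomm, List.append_assoc]

theorem flatMap_replicate (θ : ℕ → List ℕ) (n k x b : ℕ) (h : θ x = List.replicate k b) :
    (List.replicate n x).flatMap θ = List.replicate (n * k) b := by
  induction n with
  | zero => simp
  | succ n ih =>
    rw [List.replicate_succ, List.flatMap_cons, ih, h, ← List.replicate_add]
    congr 1
    ring

/-- The value of `w` under an evaluation of the letters in `S(W_i)` is `0` as soon as the value
of `x` is not `1`. -/
def Vanishing (i x : ℕ) (w : List ℕ) : Prop :=
  (∃ p q, w = p ++ List.replicate (i + 1) x ++ q) ∨ i + 2 ≤ w.count x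

/-- The letter x is repeated, so its image would be a positive power of a. The value then contains
a^(i+1) as a block or has at least i+2 letters a. -/
theorem not_isBlock_of_vanishing (hat : a ≠ t) (hi : 1 ≤ i) {x : ℕ} {w : List ℕ}
    (h : Vanishing i x w) {θ : ℕ → List ℕ} (hx : θ x ≠ []) :
    ¬ IsBlock a t i (w.flatMap θ) := by
  intro hb
  have hcount : i + 1 ≤ w.count x := by
    rcases h with ⟨p, q, rfl⟩ | h
    · simp only [List.count_append, List.count_replicate_self]
      omega
    · omega
  have ha : ∀ c ∈ θ x, c = a := by
    intro c hc
    by_contra hca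
    have h1 := hb.count_le_one hca
    have h2 := count_le_count_flatMap hc w
    omega
  have hθ := List.eq_replicate_of_mem ha
  have hpos := List.length_pos_iff.2 hx
  rcases h with ⟨p, q, rfl⟩ | h
  · rw [List.flatMap_append, List.flatMap_append, flatMap_replicate θ _ _ _ _ hθ] at hb
    obtain ⟨m, hm⟩ := Nat.exists_eq_add_of_le (Nat.le_mul_of_pos_right (i + 1) hpos)
    rw [hm, List.replicate_add, ← List.append_assoc, List.append_assoc] at hb
    exact not_isBlock_replicate hat _ _ hb
  · have hmem : a ∈ θ x := by
      obtain ⟨c, hc⟩ := List.exists_mem_of_ne_nil _ hx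
      exact ha c hc ▸ hc
    have h1 := hb.count_le hat
    have h2 := count_le_count_flatMap hmem w
    omega

theorem flatMap_filter_ne {θ : ℕ → List ℕ} {x : ℕ} (hx : θ x = []) (w : List ℕ) :
    (w.filter fun c => decide (c ≠ x)).flatMap θ = w.flatMap θ := by
  induction w with
  | nil => rfl
  | cons c w ih =>
    by_cases h : c = x
    · subst h
      simpa [hx] using ih
    · rw [List.filter_cons_of_pos (by simpa using h), List.flatMap_cons, List.flatMap_cons, ih]

theorem sat_of_vanishing (hat : a ≠ t) (hi : 1 ≤ i) {x : ℕ} {u v : List ℕ}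
    (hu : Vanishing i x u) (hv : Vanishing i x v)
    (h : u.filter (fun c => decide (c ≠ x)) = v.filter fun c => decide (c ≠ x)) :
    Sat (SMonoid (wordSet a t i)) u v := by
  rw [sat_SMonoid_iff]
  intro θ
  by_cases hx : θ x = []
  · left
    rw [← flatMap_filter_ne hx, h, flatMap_filter_ne hx]
  · exact Or.inr ⟨not_isBlock_of_vanishing hat hi hu hx, not_isBlock_of_vanishing hat hi hv hx⟩

variable (a t i) in
/-- The finite basis of `S(W_i)`. -/
abbrev basisSMonoid : Set Identity := boundedIdentities (SMonoid (wordSet a t i)) (2 * i + 10)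

theorem derives_pattern_swap (p q : List ℕ) (hx : 0 ∈ p ++ q) (hy : 1 ∈ p ++ q)
    (hl : p.length + q.length ≤ 4) (hb : ∀ x ∈ p ++ q, x < 4) (θ : ℕ → List ℕ) :
    Derives (basisSMonoid a t i) ((p ++ 0 :: 1 :: q).flatMap θ) ((p ++ 1 :: 0 :: q).flatMap θ) := by
  refine derives_subst (sat_swap hx hy) ?_ ⟨?_, ?_⟩ ⟨?_, ?_⟩ θ
  · intro x
    simp only [List.mem_append, List.mem_cons]
    tauto
  · simp only [List.length_append, List.length_cons]
    omega
  · intro x h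
    have := hb x
    simp only [List.mem_append, List.mem_cons] at h this
    rcases h with h | rfl | rfl | h
    · have := this (Or.inl h); omega
    · omega
    · omega
    · have := this (Or.inr h); omega
  · simp only [List.length_append, List.length_cons]
    omega
  · intro x h
    have := hb x
    simp only [List.mem_append, List.mem_cons] at h this
    rcases h with h | rfl | rfl | h
    · have := this (Or.inl h); omega
    · omega
    · omega
    · have := this (Or.inr h); omega

theorem derives_swap {p q : List ℕ} {x y : ℕ} (hx : x ∈ p ++ q) (hy : y ∈ p ++ q) :
    Derives (basisSMonoid a t i) (p ++ x :: y :: q) (p ++ y :: x :: q) := by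
  by_cases hxy : x = y
  · exact Derives.of_eq (by rw [hxy])
  have aux : ∀ {x y : ℕ} {p q : List ℕ}, x ∈ p → y ∈ q →
      Derives (basisSMonoid a t i) (p ++ x :: y :: q) (p ++ y :: x :: q) := by
    intro x y p q hx hy
    obtain ⟨p1, p2, rfl⟩ := List.append_of_mem hx
    obtain ⟨q1, q2, rfl⟩ := List.append_of_mem hy
    have := derives_pattern_swap (a := a) (t := t) (i := i) [0, 2] [3, 1] (by decide) (by decide)
      (by decide) (by decide) (fun n => if n = 0 then [x] else if n = 1 then [y] else
        if n = 2 then p2 else q1)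
    simpa using this.context p1 q2
  rcases List.mem_append.1 hx with hx | hx <;> rcases List.mem_append.1 hy with hy | hy
  · obtain ⟨p1, p2, rfl⟩ := List.append_of_mem hx
    rcases List.mem_append.1 hy with hy | hy
    · obtain ⟨p0, p1, rfl⟩ := List.append_of_mem hy
      have := derives_pattern_swap (a := a) (t := t) (i := i) [1, 2, 0, 3] [] (by decide)
        (by decide) (by decide) (by decide) (fun n => if n = 0 then [x] else if n = 1 then [y] else
          if n = 2 then p1 else p2)
      simpa using this.context p0 q
    · rcases List.mem_cons.1 hy with hy | hy
      · exact absurd hy.symm hxy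
      obtain ⟨p2, p3, rfl⟩ := List.append_of_mem hy
      have := derives_pattern_swap (a := a) (t := t) (i := i) [0, 2, 1, 3] [] (by decide)
        (by decide) (by decide) (by decide) (fun n => if n = 0 then [x] else if n = 1 then [y] else
          if n = 2 then p2 else p3)
      simpa using this.context p1 q
  · exact aux hx hy
  · exact (aux hy hx).symm
  · obtain ⟨p1, p2, rfl⟩ := List.append_of_mem hx
    rcases List.mem_append.1 hy with hy | hy
    · obtain ⟨p0, p1, rfl⟩ := List.append_of_mem hy
      have := derives_pattern_swap (a := a) (t := t) (i := i) [] [2, 1, 3, 0] (by decide)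
        (by decide) (by decide) (by decide) (fun n => if n = 0 then [x] else if n = 1 then [y] else
          if n = 2 then p0 else p1)
      simpa using this.context p p2
    · rcases List.mem_cons.1 hy with hy | hy
      · exact absurd hy.symm hxy
      obtain ⟨p2, p3, rfl⟩ := List.append_of_mem hy
      have := derives_pattern_swap (a := a) (t := t) (i := i) [] [2, 0, 3, 1] (by decide)
        (by decide) (by decide) (by decide) (fun n => if n = 0 then [x] else if n = 1 then [y] else
          if n = 2 then p1 else p2)
      simpa using this.context p p3

/-- A segment without linear letters may be permuted arbitrarily. -/
theorem derives_perm {w w' : List ℕ} (h : w.Perm w') : ∀ p q : List ℕ,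
    (∀ c ∈ w, 2 ≤ (p ++ w ++ q).count c) →
      Derives (basisSMonoid a t i) (p ++ w ++ q) (p ++ w' ++ q) := by
  induction h with
  | nil => exact fun _ _ _ => Derives.refl _
  | @cons x w w' _ ih =>
    intro p q hc
    have := ih (p ++ [x]) q (fun c hc' => by simpa using hc c (List.mem_cons_of_mem _ hc'))
    simpa using this
  | swap x y l =>
    intro p q hc
    by_cases hxy : x = y
    · exact Derives.of_eq (by rw [hxy])
    have hx := hc x (by simp)
    have hy := hc y (by simp)
    have := derives_swap (a := a) (t := t) (i := i) (p := p) (q := l ++ q) (x := y) (y := x)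
      (by
        rw [← List.count_pos_iff]
        simp only [List.count_append, List.count_cons_self, List.count_cons_of_ne hxy] at hy ⊢
        omega)
      (by
        rw [← List.count_pos_iff]
        simp only [List.count_append, List.count_cons_self,
          List.count_cons_of_ne (Ne.symm hxy)] at hx ⊢
        omega)
    simpa using this
  | @trans w1 w2 w3 h1 _ ih1 ih2 =>
    intro p q hc
    refine (ih1 p q hc).trans (ih2 p q fun c hc' => ?_)
    have hperm : (p ++ w2 ++ q).Perm (p ++ w1 ++ q) := (h1.symm.append_left p).append_right q
    rw [hperm.count_eq]
    exact hc c (h1.mem_iff.2 hc')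

theorem perm_replicate_append_filter (x : ℕ) (w : List ℕ) :
    w.Perm (List.replicate (w.count x) x ++ w.filter fun c => decide (c ≠ x)) := by
  rw [← filter_eq_replicate]
  have := (List.filter_append_perm (fun c => decide (c = x)) w).symm
  simpa using this

section Power

theorem derives_power_comm (hat : a ≠ t) (hi : 1 ≤ i) (x : ℕ) (w : List ℕ) :
    Derives (basisSMonoid a t i) (w ++ List.replicate (i + 1) x)
      (List.replicate (i + 1) x ++ w) := by
  have h := derives_subst (N := 2 * i + 10) (u := 1 :: List.replicate (i + 1) 0)
    (v := List.replicate (i + 1) 0 ++ [1])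
    (sat_of_vanishing (x := 0) hat hi (Or.inl ⟨[1], [], by simp⟩) (Or.inl ⟨[], [1], by simp⟩)
      (by simp))
    (by simp [or_comm]) ⟨by simp; omega, by simp⟩ ⟨by simp; omega, by simp⟩
    (fun n => if n = 0 then [x] else w)
  simpa [flatMap_replicate _ _ 1 0 x] using h

theorem derives_power_succ (hat : a ≠ t) (hi : 1 ≤ i) (x : ℕ) :
    Derives (basisSMonoid a t i) (List.replicate (i + 1) x ++ [x])
      (List.replicate (i + 1) x) := by
  have h := derives_subst (N := 2 * i + 10) (u := List.replicate (i + 1) 0 ++ [0])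
    (v := List.replicate (i + 1) 0)
    (sat_of_vanishing (x := 0) hat hi (Or.inl ⟨[], [0], by simp⟩) (Or.inl ⟨[], [], by simp⟩)
      (by simp))
    (by simp) ⟨by simp; omega, by simp⟩ ⟨by simp; omega, by simp⟩ (fun _ => [x])
  simpa [flatMap_replicate _ _ 1 0 x] using h

theorem derives_power_absorb (hat : a ≠ t) (hi : 1 ≤ i) (x : ℕ) (w : List ℕ) :
    Derives (basisSMonoid a t i) (List.replicate (i + 1) x ++ w)
      (List.replicate (i + 1) x ++ w.filter fun c => decide (c ≠ x)) := by
  induction w with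
  | nil => exact Derives.refl _
  | cons c w ih =>
    by_cases h : c = x
    · subst h
      rw [List.filter_cons_of_neg (by simp)]
      have := (derives_power_succ (a := a) (t := t) hat hi c).append (Derives.refl w)
      rw [List.append_assoc] at this
      exact this.trans ih
    · rw [List.filter_cons_of_pos (by simpa using h)]
      have h1 := fun w' => (derives_power_comm (a := a) (t := t) hat hi x [c]).symm.append
        (Derives.refl w')
      have h2 := (Derives.refl [c]).append ih
      simp only [List.append_assoc, List.cons_append, List.nil_append] at h1 h2
      exact (h1 w).trans (h2.trans (h1 _).symm)

/-- The word `z₀ x z₁ x ⋯ x zₘ` with `x = 0` and `zₖ = k + 1`. -/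
def separated (m : ℕ) : List ℕ := ((List.range m).flatMap fun k => [k + 1, 0]) ++ [m + 1]

theorem separated_succ (m : ℕ) : separated (m + 1) = separated m ++ [0, m + 2] := by
  simp [separated, List.range_succ]

/-- One pattern thus serves all words with m occurrences of x: the gaps between them become the
values of the letters zₖ. -/
theorem exists_separated (x : ℕ) (m : ℕ) : ∀ u : List ℕ, u.count x = m →
    ∃ f : ℕ → List ℕ, (separated m).flatMap (fun n => if n = 0 then [x] else f n) = u := by
  induction m with
  | zero =>
    intro u hu
    exact ⟨fun _ => u, by simp [separated]⟩
  | succ m ih =>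
    intro u hu
    obtain ⟨p, q, rfl, hq⟩ :=
      exists_last_occurrence (List.count_pos_iff.1 (by omega : 0 < u.count x))
    have hp : p.count x = m := by
      have := List.count_eq_zero.2 hq
      simp at hu
      omega
    obtain ⟨f, hf⟩ := ih p hp
    refine ⟨fun n => if n = m + 2 then q else f n, ?_⟩
    rw [separated_succ, List.flatMap_append]
    have hlt : ∀ n ∈ separated m, n ≠ m + 2 := by
      intro n hn
      simp only [separated, List.mem_append, List.mem_flatMap, List.mem_range, List.mem_cons,
        List.not_mem_nil, or_false] at hn
      rcases hn with ⟨k, hk, rfl | rfl⟩ | rfl <;> omega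
    rw [flatMap_congr_mem (η := fun n => if n = 0 then [x] else f n)
      (fun n hn => by simp only [if_neg (hlt n hn)]), hf]
    simp

theorem length_separated (m : ℕ) : (separated m).length = 2 * m + 1 := by
  induction m with
  | zero => rfl
  | succ m ih => rw [separated_succ, List.length_append, ih]; simp; ring

theorem lt_of_mem_separated {m n : ℕ} (h : n ∈ separated m) : n < m + 2 := by
  simp only [separated, List.mem_append, List.mem_flatMap, List.mem_range, List.mem_cons,
    List.not_mem_nil, or_false] at h
  rcases h with ⟨k, hk, rfl | rfl⟩ | rfl <;> omega

theorem count_separated (m : ℕ) : (separated m).count 0 = m := by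
  induction m with
  | zero => rfl
  | succ m ih => rw [separated_succ, List.count_append, ih]; simp

/-- Both `separated (i + 2)` and its rearrangement with all zeros moved to the front vanish on 0, so
they form an identity. The word `w` is controlled only up to the letter x, which
`derives_power_absorb` removes later. -/
theorem derives_of_count_eq (hat : a ≠ t) (hi : 1 ≤ i) {x : ℕ} {u : List ℕ}
    (hu : u.count x = i + 2) : ∃ w, w.filter (fun c => decide (c ≠ x)) =
      u.filter (fun c => decide (c ≠ x)) ∧
      Derives (basisSMonoid a t i) u (List.replicate (i + 1) x ++ w) := by
  obtain ⟨f, hf⟩ := exists_separated x (i + 2) u hu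
  have hlen := length_separated (i + 2)
  have hmem : (0 : ℕ) ∈ separated (i + 2) := by
    rw [← List.count_pos_iff, count_separated]
    omega
  have h := derives_subst (N := 2 * i + 10) (u := separated (i + 2))
    (v := List.replicate (i + 1) 0 ++ (separated (i + 2)).filter fun c => decide (c ≠ 0))
    (sat_of_vanishing (x := 0) hat hi (Or.inr (by rw [count_separated]))
      (Or.inl ⟨[], _, by simp; rfl⟩) (by simp [List.filter_filter]))
    (by
      intro n
      by_cases hn : n = 0
      · simp [hn, hmem]
      · simp [hn])
    ⟨by omega, fun n hn => by have := lt_of_mem_separated hn; omega⟩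
    ⟨by
      have h1 := (perm_replicate_append_filter 0 (separated (i + 2))).length_eq
      rw [count_separated, List.length_append, List.length_replicate] at h1
      rw [List.length_append, List.length_replicate]
      omega, fun n hn => by
      rcases List.mem_append.1 hn with hn | hn
      · have := List.eq_of_mem_replicate hn
        omega
      · have := lt_of_mem_separated (List.mem_of_mem_filter hn)
        omega⟩
    (fun n => if n = 0 then [x] else f n)
  rw [hf, List.flatMap_append, flatMap_replicate _ _ 1 0 x (by simp), mul_one] at h
  refine ⟨_, ?_, h⟩
  rw [← hf]
  generalize separated (i + 2) = s
  induction s with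
  | nil => rfl
  | cons n s ih =>
    by_cases hn : n = 0
    · subst hn
      simpa using ih
    · rw [List.filter_cons_of_pos (by simpa using hn), List.flatMap_cons, List.flatMap_cons,
        List.filter_append, List.filter_append, ih]

theorem exists_prefix_count (x : ℕ) (u : List ℕ) {n : ℕ} (h : n ≤ u.count x) :
    ∃ p q, u = p ++ q ∧ p.count x = n := by
  induction u generalizing n with
  | nil => exact ⟨[], [], rfl, (Nat.le_zero.1 h).symm⟩
  | cons c u ih =>
    rcases n with _ | n
    · exact ⟨[], c :: u, rfl, rfl⟩
    · by_cases hc : c = x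
      · subst hc
        obtain ⟨p, q, rfl, hp⟩ := ih (n := n) (by simpa using h)
        exact ⟨c :: p, q, rfl, by simp [hp]⟩
      · obtain ⟨p, q, rfl, hp⟩ := ih (n := n + 1) (by rwa [List.count_cons_of_ne hc] at h)
        exact ⟨c :: p, q, rfl, by rw [List.count_cons_of_ne hc, hp]⟩

/-- The letter `x` is free in `u`: the word `u` is equivalent to a word starting with `x^(i+1)`
in which `x` does not occur elsewhere. -/
def Free (i x : ℕ) (u : List ℕ) : Prop :=
  i + 2 ≤ u.count x ∨ (u.count x = i + 1 ∧
    ∀ s, s ≠ x → u.count s = 1 → ¬ ([x, s].Sublist u ∧ [s, x].Sublist u))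

/-- With at least i+2 occurrences, a prefix containing exactly i+2 suffices and the power absorbs
the rest. With i+1, the segment from the first to the last x has no linear letter, so it can be
permuted to gather x^(i+1), which is central. -/
theorem derives_of_free (hat : a ≠ t) (hi : 1 ≤ i) {x : ℕ} {u : List ℕ} (h : Free i x u) :
    Derives (basisSMonoid a t i) u
      (List.replicate (i + 1) x ++ u.filter fun c => decide (c ≠ x)) := by
  rcases h with h | ⟨h, hs⟩
  · obtain ⟨p, q, rfl, hp⟩ := exists_prefix_count x u h
    obtain ⟨w, hw, hd⟩ := derives_of_count_eq (a := a) (t := t) hat hi hp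
    have h1 := hd.append (Derives.refl q)
    have h2 := derives_power_absorb (a := a) (t := t) hat hi x (w ++ q)
    rw [List.filter_append, hw, ← List.filter_append, ← List.append_assoc] at h2
    exact h1.trans h2
  · obtain ⟨p, r, rfl, hp⟩ :=
      List.eq_append_cons_of_mem (List.count_pos_iff.1 (by omega : 0 < u.count x))
    have hp0 := List.count_eq_zero.2 hp
    have hr : r.count x = i := by
      simp only [List.count_append, List.count_cons_self] at h
      omega
    obtain ⟨m, q, rfl, hq⟩ :=
      exists_last_occurrence (List.count_pos_iff.1 (by omega : 0 < r.count x))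
    have hq0 := List.count_eq_zero.2 hq
    have hu : p ++ x :: (m ++ x :: q) = p ++ (x :: (m ++ [x])) ++ q := by simp
    rw [hu] at h hs ⊢
    set w := x :: (m ++ [x]) with hw
    have hwx : w.count x = i + 1 := by
      simp only [List.count_append] at h
      omega
    have h1 := derives_perm (a := a) (t := t) (i := i) (perm_replicate_append_filter x w) p q (by
      intro c hc
      by_cases hcx : c = x
      · rw [hcx, h]
        omega
      · have hcm : c ∈ m := by simpa [hw, hcx] using hc
        have hpos : 0 < (p ++ w ++ q).count c := List.count_pos_iff.2 (by simp [hc])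
        have hne : (p ++ w ++ q).count c ≠ 1 := by
          intro h1
          refine hs c hcx h1 ⟨?_, ?_⟩
          · simp only [pair_sublist_append, hw, pair_sublist_cons]
            simp [hcm]
          · simp only [pair_sublist_append, hw, pair_sublist_cons]
            simp [hcm]
        omega)
    rw [hwx] at h1
    have h2 := (derives_power_comm (a := a) (t := t) hat hi x p).append
      (Derives.refl (w.filter (fun c => decide (c ≠ x)) ++ q))
    have h3 := derives_power_absorb (a := a) (t := t) hat hi x
      (p ++ (w.filter (fun c => decide (c ≠ x)) ++ q))
    simp only [List.filter_append, List.filter_filter, Bool.and_self] at h3 ⊢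
    simp only [List.append_assoc] at h1 h2 h3 ⊢
    exact h1.trans (h2.trans h3)

end Power

end

/-! ### A finite basis of S(W_i): words without free letters -/

theorem restrict_comm (x s : ℕ) (u : List ℕ) : restrict x s u = restrict s x u :=
  List.filter_congr fun c _ => by simp only [or_comm]

theorem restrict_append (x s : ℕ) (u v : List ℕ) :
    restrict x s (u ++ v) = restrict x s u ++ restrict x s v := List.filter_append _ _

theorem count_restrict_left (x s : ℕ) (u : List ℕ) : (restrict x s u).count x = u.count x :=
  List.count_filter (by simp)

theorem pair_sublist_restrict (x s : ℕ) (u : List ℕ) :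
    [x, s].Sublist (restrict x s u) ↔ [x, s].Sublist u := by
  constructor
  · exact fun h => h.trans List.filter_sublist
  · intro h
    have := h.filter fun c => decide (c = x ∨ c = s)
    simpa [restrict] using this

theorem pair_sublist_iff_of_restrict_eq {x s : ℕ} {u v : List ℕ}
    (h : restrict x s u = restrict x s v) :
    ([x, s].Sublist u ↔ [x, s].Sublist v) ∧ ([s, x].Sublist u ↔ [s, x].Sublist v) := by
  constructor
  · rw [← pair_sublist_restrict, h, pair_sublist_restrict]
  · rw [← pair_sublist_restrict, restrict_comm, h, restrict_comm, pair_sublist_restrict]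

theorem pair_sublist_split {x s : ℕ} {p q : List ℕ} (hx : x ≠ s) (hp : s ∉ p) (hq : s ∉ q) :
    ([x, s].Sublist (p ++ s :: q) ↔ x ∈ p) ∧ ([s, x].Sublist (p ++ s :: q) ↔ x ∈ q) := by
  have h1 : ∀ {y : ℕ}, ¬ [s, y].Sublist p := fun h => hp (mem_of_pair_sublist h).1
  have h2 : ∀ {y : ℕ}, ¬ [y, s].Sublist p := fun h => hp (mem_of_pair_sublist h).2
  have h4 : ∀ {y : ℕ}, ¬ [y, s].Sublist q := fun h => hq (mem_of_pair_sublist h).2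
  simp [pair_sublist_append, pair_sublist_cons, h1, h2, h4, hp, hx]

/-- The words `u` and `v` have the same letters with the same multiplicities, in the same
positions relative to the linear letters. -/
def SamePositions (u v : List ℕ) : Prop :=
  (∀ x, u.count x = v.count x) ∧
    ∀ s x, x ≠ s → u.count s = 1 → restrict x s u = restrict x s v

section

variable {a t i : ℕ}

/-- The next letter b of the target is brought forward past the letters r before its first
occurrence. No letter so permuted is linear, since a linear one would force the same order in both
words. -/
theorem derives_of_samePositions (v' : List ℕ) : ∀ p u' : List ℕ,
    SamePositions (p ++ u') (p ++ v') →
      Derives (basisSMonoid a t i) (p ++ u') (p ++ v') := by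
  induction v' with
  | nil =>
    intro p u' h
    have : u' = [] := by
      rw [List.eq_nil_iff_forall_not_mem]
      intro x hx
      have h1 := List.count_pos_iff.2 hx
      have h2 := h.1 x
      simp only [List.count_append, List.count_nil] at h2
      omega
    rw [this]
    exact Derives.refl _
  | cons b v ih =>
    intro p u' h
    have hb : b ∈ u' := by
      rw [← List.count_pos_iff]
      have := h.1 b
      simp only [List.count_append, List.count_cons_self] at this
      omega
    obtain ⟨r, u, rfl, hr⟩ := List.eq_append_cons_of_mem hb
    have hne : ∀ c ∈ r, restrict c b (p ++ (r ++ b :: u)) ≠ restrict c b (p ++ b :: v) := by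
      intro c hc heq
      have hcb : b ≠ c := fun k => hr (k ▸ hc)
      rw [restrict_append _ _ p, restrict_append _ _ p, List.append_cancel_left_eq, restrict_append,
        restrict_eq_replicate hr, restrict, restrict, List.filter_cons_of_pos (l := v) (by simp)]
        at heq
      obtain ⟨m, hm⟩ := Nat.exists_eq_succ_of_ne_zero (List.count_pos_iff.2 hc).ne'
      rw [hm, List.replicate_succ, List.cons_append, List.cons.injEq] at heq
      exact hcb heq.1.symm
    have hcount : ∀ c, 0 < (p ++ (r ++ b :: u)).count c → (p ++ (r ++ b :: u)).count c ≠ 1 →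
        2 ≤ (p ++ (r ++ [b]) ++ u).count c := by
      intro c h1 h2
      have : p ++ (r ++ [b]) ++ u = p ++ (r ++ b :: u) := by simp
      rw [this]
      omega
    have hnl : ∀ c ∈ r ++ [b], r ≠ [] → (p ++ (r ++ b :: u)).count c ≠ 1 := by
      intro c hc hrn h1
      rcases List.mem_append.1 hc with hc | hc
      · have hcb : b ≠ c := fun k => hr (k ▸ hc)
        refine hne c hc ?_
        rw [restrict_comm, h.2 c b hcb h1, restrict_comm]
      · obtain rfl := List.mem_singleton.1 hc
        obtain ⟨d, hd⟩ := List.exists_mem_of_ne_nil _ hrn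
        have hcb : d ≠ c := fun k => hr (k ▸ hd)
        exact hne d hd (h.2 c d hcb h1)
    by_cases hrn : r = []
    · subst hrn
      have := ih (p ++ [b]) u (by simpa using h)
      simpa using this
    · have hperm : (r ++ [b]).Perm (b :: r) := List.perm_append_singleton b r
      have h1 := derives_perm (a := a) (t := t) (i := i) hperm p u fun c hc =>
        hcount c (List.count_pos_iff.2 (by
          simp only [List.mem_append, List.mem_cons, List.not_mem_nil, or_false] at hc ⊢
          tauto)) (hnl c hc hrn)
      -- The permuted segment contains no linear letter s, so its restriction depends only on the
      -- multiplicity of x.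
      have hsame : SamePositions (p ++ [b] ++ (r ++ u)) (p ++ [b] ++ v) := by
        have hpu : (p ++ [b] ++ (r ++ u)).Perm (p ++ (r ++ b :: u)) := by
          simpa using (hperm.symm.append_right u).append_left p
        refine ⟨fun x => ?_, fun s x hxs hs => ?_⟩
        · rw [hpu.count_eq, h.1 x]
          simp
        · rw [hpu.count_eq] at hs
          have hsn : s ∉ r ++ [b] := fun k => hnl s k hrn hs
          have hsn' : s ∉ b :: r := fun k => hsn (hperm.mem_iff.2 k)
          have e1 : p ++ [b] ++ (r ++ u) = p ++ ((b :: r) ++ u) := by simp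
          have e2 : p ++ (r ++ b :: u) = p ++ ((r ++ [b]) ++ u) := by simp
          have e3 : p ++ [b] ++ v = p ++ b :: v := by simp
          rw [e3, ← h.2 s x hxs hs, e1, e2, restrict_append, restrict_append, restrict_append,
            restrict_append, restrict_eq_replicate hsn, restrict_eq_replicate hsn',
            hperm.count_eq]
      have h2 := ih (p ++ [b]) (r ++ u) hsame
      simp only [List.append_assoc, List.cons_append, List.nil_append] at h1 h2 ⊢
      exact h1.trans h2

/-- If x were not free in `v`, it would occur i+1 times around some linear s. That configuration is
preserved by the identity, so x would not be free in `u`. -/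
theorem free_of_sat (hat : a ≠ t) (hi : 1 ≤ i) {u v : List ℕ} {x : ℕ}
    (h : Sat (SMonoid (wordSet a t i)) u v) (hu : Free i x u) : Free i x v := by
  have hux : i + 1 ≤ u.count x := by
    rcases hu with hu | hu <;> omega
  have hvx : i + 1 ≤ v.count x := by
    by_contra hlt
    have := count_eq_of_sat hi h.symm (by omega : v.count x ≤ i)
    omega
  by_cases hv : i + 2 ≤ v.count x
  · exact Or.inl hv
  · refine Or.inr ⟨by omega, fun s hsx hs hbetween => ?_⟩
    have heq := restrict_eq_of_sat hat hi h.symm hsx.symm hs (by omega) (Or.inr hbetween)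
    have hpair := pair_sublist_iff_of_restrict_eq heq
    have hcx : u.count x = v.count x := by
      rw [← count_restrict_left x s u, ← heq, count_restrict_left]
    have hcs : u.count s = 1 := by
      rw [← hs, ← count_restrict_left s x u, restrict_comm, ← heq, restrict_comm,
        count_restrict_left]
    rcases hu with hu | hu
    · omega
    · exact hu.2 s hsx hcs ⟨hpair.1.1 hbetween.1, hpair.2.1 hbetween.2⟩

/-- If all occurrences of `x` lie on one side of the linear letter `s`, but the linear letter `s'`
lies between two occurrences of `x`, then the positions of `x` relative to `s` are determined by
those of `s'`. -/
theorem restrict_eq_of_not_between {u v : List ℕ} {x s s' : ℕ} (hxs : x ≠ s)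
    (hus : u.count s = 1) (hvs : v.count s = 1) (hus' : u.count s' = 1) (hvs' : v.count s' = 1)
    (hc : u.count x = v.count x)
    (hu' : [x, s'].Sublist u ∧ [s', x].Sublist u) (hv' : [x, s'].Sublist v ∧ [s', x].Sublist v)
    (hu : ¬ ([x, s].Sublist u ∧ [s, x].Sublist u)) (hv : ¬ ([x, s].Sublist v ∧ [s, x].Sublist v))
    (hss : ([s, s'].Sublist u ↔ [s, s'].Sublist v) ∧ ([s', s].Sublist u ↔ [s', s].Sublist v)) :
    restrict x s u = restrict x s v := by
  have hne : s' ≠ s := by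
    rintro rfl
    exact hu hu'
  obtain ⟨p, q, rfl, hp, hq⟩ := exists_linear_split hus
  obtain ⟨p', q', rfl, hp', hq'⟩ := exists_linear_split hvs
  rw [(pair_sublist_split hxs hp hq).1, (pair_sublist_split hxs hp hq).2] at hu
  rw [(pair_sublist_split hxs hp' hq').1, (pair_sublist_split hxs hp' hq').2] at hv
  rw [(pair_sublist_split hne hp hq).1, (pair_sublist_split hne hp hq).2,
    (pair_sublist_split hne hp' hq').1, (pair_sublist_split hne hp' hq').2] at hss
  have side : ∀ {p q : List ℕ}, ¬ (x ∈ p ∧ x ∈ q) → (p ++ s :: q).count s' = 1 →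
      ([x, s'].Sublist (p ++ s :: q) ∧ [s', x].Sublist (p ++ s :: q)) →
      (x ∈ p ∧ s' ∈ p ∧ x ∉ q ∧ s' ∉ q) ∨ (x ∈ q ∧ s' ∈ q ∧ x ∉ p ∧ s' ∉ p) := by
    intro p q h1 h2 ⟨h3, h4⟩
    simp only [List.count_append, List.count_cons_of_ne hne.symm] at h2
    have h5 : s' ∈ p → s' ∉ q := by
      intro k1 k2
      have := List.count_pos_iff.2 k1
      have := List.count_pos_iff.2 k2
      omega
    simp only [pair_sublist_append, pair_sublist_cons, List.mem_cons, hxs, hne, false_or,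
      false_and] at h3 h4
    have k3 : (x ∈ p ∧ s' ∈ p) ∨ (x ∈ p ∧ s' ∈ q) ∨ (x ∈ q ∧ s' ∈ q) :=
      h3.imp mem_of_pair_sublist fun h => h.imp id mem_of_pair_sublist
    have k4 : (s' ∈ p ∧ x ∈ p) ∨ (s' ∈ p ∧ x ∈ q) ∨ (s' ∈ q ∧ x ∈ q) :=
      h4.imp mem_of_pair_sublist fun h => h.imp id mem_of_pair_sublist
    clear h2 h3 h4
    grind
  simp only [List.count_append, List.count_cons_of_ne hxs.symm] at hc
  rw [restrict_split hp hq, restrict_split hp' hq']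
  rcases side hu hus' hu' with h1 | h1 <;> rcases side hv hvs' hv' with h2 | h2
  · have e1 := List.count_eq_zero.2 h1.2.2.1
    have e2 := List.count_eq_zero.2 h2.2.2.1
    rw [e1, e2] at hc ⊢
    rw [show p.count x = p'.count x by omega]
  · exact absurd (hss.2.1 h1.2.1) h2.2.2.2
  · exact absurd (hss.2.2 h2.2.1) h1.2.2.2
  · have e1 := List.count_eq_zero.2 h1.2.2.1
    have e2 := List.count_eq_zero.2 h2.2.2.1
    rw [e1, e2] at hc ⊢
    rw [show q.count x = q'.count x by omega]

/-- A non-free letter x occurs at most i times, or i+1 times around some linear s'. The only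
positions not read off directly are those relative to a linear s with all x on one side in both
words; the order of s and s' settles them. -/
theorem samePositions_of_sat (hat : a ≠ t) (hi : 1 ≤ i) {u v : List ℕ}
    (h : Sat (SMonoid (wordSet a t i)) u v) (hu : ∀ x, ¬ Free i x u) : SamePositions u v := by
  have hcases : ∀ x, u.count x ≤ i ∨ (u.count x = i + 1 ∧
      ∃ s, s ≠ x ∧ u.count s = 1 ∧ [x, s].Sublist u ∧ [s, x].Sublist u) := by
    intro x
    have := hu x
    rw [Free, not_or] at this
    by_cases hx : u.count x ≤ i
    · exact Or.inl hx
    · right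
      have hx1 : u.count x = i + 1 := by omega
      refine ⟨hx1, ?_⟩
      by_contra! hcon
      exact this.2 ⟨hx1, fun s h1 h2 h3 => hcon s h1 h2 h3.1 h3.2⟩
  have hcount : ∀ x, u.count x = v.count x := by
    intro x
    rcases hcases x with hx | ⟨hx, s, hsx, hs, hb⟩
    · exact (count_eq_of_sat hi h hx).symm
    · rw [← count_restrict_left x s u,
        restrict_eq_of_sat hat hi h hsx.symm hs hx.le (Or.inr hb), count_restrict_left]
  refine ⟨hcount, fun s x hxs hs => ?_⟩
  rcases hcases x with hx | ⟨hx, s', hsx, hs', hb⟩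
  · exact restrict_eq_of_sat hat hi h hxs hs (by omega) (Or.inl hx)
  · by_cases hbu : [x, s].Sublist u ∧ [s, x].Sublist u
    · exact restrict_eq_of_sat hat hi h hxs hs hx.le (Or.inr hbu)
    by_cases hbv : [x, s].Sublist v ∧ [s, x].Sublist v
    · exact (restrict_eq_of_sat hat hi h.symm hxs (hcount s ▸ hs) (hcount x ▸ hx.le)
        (Or.inr hbv)).symm
    have hne : s ≠ s' := by
      rintro rfl
      exact hbu hb
    have heq := restrict_eq_of_sat hat hi h hsx.symm hs' hx.le (Or.inr hb)
    have hpair := pair_sublist_iff_of_restrict_eq heq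
    have hss := restrict_eq_of_sat hat hi h hne hs' (by omega) (Or.inl (by omega))
    exact restrict_eq_of_not_between hxs hs (hcount s ▸ hs) hs' (hcount s' ▸ hs')
      (hcount x) hb ⟨hpair.1.1 hb.1, hpair.2.1 hb.2⟩ hbu hbv
      (pair_sublist_iff_of_restrict_eq hss)

/-- A free letter is gathered in front on both sides and deleted from the identity, which shortens
the word. -/
theorem derives_of_sat (hat : a ≠ t) (hi : 1 ≤ i) (n : ℕ) : ∀ u v : List ℕ, u.length = n →
    Sat (SMonoid (wordSet a t i)) u v → Derives (basisSMonoid a t i) u v := by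
  induction n using Nat.strong_induction_on with
  | _ n ih =>
    intro u v hn h
    by_cases hfree : ∃ x, Free i x u
    · obtain ⟨x, hx⟩ := hfree
      have hlt : (u.filter fun c => decide (c ≠ x)).length < n := by
        have h1 := (perm_replicate_append_filter x u).length_eq
        rw [List.length_append, List.length_replicate] at h1
        rcases hx with hx | hx <;> omega
      exact (derives_of_free hat hi hx).trans
        (((Derives.refl _).append (ih _ hlt _ _ rfl (h.filter _))).trans
          (derives_of_free hat hi (free_of_sat hat hi h hx)).symm)
    · push Not at hfree
      exact derives_of_samePositions v [] u (samePositions_of_sat hat hi h hfree)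

theorem finitelyBased_SMonoid (hat : a ≠ t) (hi : 1 ≤ i) :
    FinitelyBased (SMonoid (wordSet a t i)) :=
  -- The longest identity used starts from `separated (i + 2)`, of length 2i + 5; the swaps have
  -- length at most 6.
  finitelyBased_of_derives (2 * i + 10) fun u v h => derives_of_sat hat hi _ u v rfl h

end

/-! ### Test words and the identities of the product between them -/

theorem sat_of_derives {S : Type*} [Monoid S] {N : ℕ} {u v : List ℕ}
    (h : Derives (boundedIdentities S N) u v) : Sat S u v := by
  rcases h with ⟨rfl, rfl⟩ | ⟨p, q, rfl, rfl, h⟩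
  · exact Sat.refl _
  · let c : Con (FreeSemigroup ℕ) :=
      { r := fun p q => Sat S (toWord p) (toWord q)
        iseqv := ⟨fun _ => Sat.refl _, Sat.symm, Sat.trans⟩
        mul' := by
          intro p q p' q' h h' φ
          rw [toWord_mul, toWord_mul, List.map_append, List.map_append, List.prod_append,
            List.prod_append, h φ, h' φ] }
    have hle : conGen (fun p q : FreeSemigroup ℕ => ∃ f ∈ boundedIdentities S N,
        ∃ Θ : FreeSemigroup ℕ →ₙ* FreeSemigroup ℕ, p = Θ f.1 ∧ q = Θ f.2) ≤ c := by
      refine Con.conGen_le.2 ?_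
      rintro p q ⟨f, hf, Θ, rfl, rfl⟩
      change Sat S _ _
      rw [toWord_map, toWord_map]
      exact ((satisfies_iff f).1 hf.1).subst _
    exact hle h

/-- The letters `yₖ`. -/
abbrev letterY (k : ℕ) : ℕ := 2 * k + 3

/-- The letters `zₖ`. -/
abbrev letterZ (k : ℕ) : ℕ := 2 * k + 4

/-- The word `y₀ z₀ y₁ z₁ ⋯`. -/
def alternating (n : ℕ) : List ℕ := (List.range n).flatMap fun k => [letterY k, letterZ k]

/-- The words `z₀ z₁ ⋯ t x^m y₀ z₀ y₁ z₁ ⋯ x t' y₀ y₁ ⋯` with `x = 0`, `t = 1`, `t' = 2`. -/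
def testWord (m n : ℕ) : List ℕ :=
  (List.range n).map letterZ ++
    1 :: ((List.replicate m 0 ++ alternating n ++ [0]) ++ 2 :: (List.range n).map letterY)

theorem alternating_succ (n : ℕ) :
    alternating (n + 1) = alternating n ++ [letterY n, letterZ n] := by
  simp [alternating, List.range_succ]

theorem mem_alternating {c n : ℕ} :
    c ∈ alternating n ↔ ∃ k < n, c = letterY k ∨ c = letterZ k := by
  simp [alternating]

theorem count_letterY_map_letterY {k n : ℕ} (h : k < n) :
    ((List.range n).map letterY).count (letterY k) = 1 := by
  refine List.count_eq_one_of_mem ?_ (List.mem_map_of_mem (List.mem_range.2 h))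
  exact List.nodup_range.map fun _ _ h => by simpa [letterY] using h

theorem count_letterZ_map_letterZ {k n : ℕ} (h : k < n) :
    ((List.range n).map letterZ).count (letterZ k) = 1 := by
  refine List.count_eq_one_of_mem ?_ (List.mem_map_of_mem (List.mem_range.2 h))
  exact List.nodup_range.map fun _ _ h => by simpa [letterZ] using h

theorem nodup_alternating (n : ℕ) : (alternating n).Nodup := by
  induction n with
  | zero => exact List.nodup_nil
  | succ n ih =>
    rw [alternating_succ, List.nodup_append]
    refine ⟨ih, by simp [letterY, letterZ], ?_⟩
    intro c hc d hd
    obtain ⟨k, hk, hck⟩ := mem_alternating.1 hc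
    simp only [List.mem_cons, List.not_mem_nil, or_false, letterY, letterZ] at hck hd
    omega

theorem pair_sublist_alternating {j k n : ℕ} (hj : j < n) (hk : k < n) :
    [letterY k, letterZ j].Sublist (alternating n) ↔ k ≤ j := by
  induction n with
  | zero => omega
  | succ n ih =>
    have hY : letterY k ∈ alternating n ↔ k < n := by
      rw [mem_alternating]
      constructor
      · rintro ⟨l, hl, h | h⟩ <;> simp only [letterY, letterZ] at h <;> omega
      · exact fun h => ⟨k, h, Or.inl rfl⟩
    have hZ : letterZ j ∈ alternating n ↔ j < n := by
      rw [mem_alternating]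
      constructor
      · rintro ⟨l, hl, h | h⟩ <;> simp only [letterY, letterZ] at h <;> omega
      · exact fun h => ⟨j, h, Or.inr rfl⟩
    have hmem : [letterY k, letterZ j].Sublist (alternating n) → k < n ∧ j < n := fun h =>
      ⟨hY.1 (mem_of_pair_sublist h).1, hZ.1 (mem_of_pair_sublist h).2⟩
    rw [alternating_succ, pair_sublist_append, hY]
    have e1 : letterZ j ∈ [letterY n, letterZ n] ↔ j = n := by
      simp only [letterY, letterZ, List.mem_cons, List.not_mem_nil, or_false]
      omega
    have e2 : [letterY k, letterZ j].Sublist [letterY n, letterZ n] ↔ k = n ∧ j = n := by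
      simp only [pair_sublist_cons, letterY, letterZ, List.mem_cons, List.not_mem_nil, or_false,
        List.sublist_nil, and_false]
      simp
    rw [e1, e2]
    by_cases h1 : k < n ∧ j < n
    · rw [ih h1.2 h1.1]
      omega
    · have := mt hmem h1
      simp only [this, false_or]
      omega

section TestWord

variable {m n : ℕ}

theorem count_zero_testWord : (testWord m n).count 0 = m + 1 := by
  have h : (0 : ℕ) ∉ alternating n := by
    rw [mem_alternating]
    rintro ⟨k, hk, h | h⟩ <;> simp only [letterY, letterZ] at h <;> omega
  have h1 : (0 : ℕ) ∉ (List.range n).map letterZ := by simp [letterZ]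
  have h2 : (0 : ℕ) ∉ (List.range n).map letterY := by simp [letterY]
  simp [testWord, List.count_eq_zero.2 h, List.count_eq_zero.2 h1, List.count_eq_zero.2 h2]

theorem one_not_mem : (1 : ℕ) ∉ (List.range n).map letterZ ∧
    (1 : ℕ) ∉ (List.replicate m 0 ++ alternating n ++ [0]) ++ 2 :: (List.range n).map letterY := by
  constructor
  · simp only [List.mem_map, letterZ]
    omega
  · simp only [List.mem_append, List.mem_cons, List.mem_map, List.mem_replicate, mem_alternating,
      letterY, letterZ, List.not_mem_nil]
    grind

theorem testWord_eq : testWord m n = ((List.range n).map letterZ ++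
    1 :: (List.replicate m 0 ++ alternating n ++ [0])) ++ 2 :: (List.range n).map letterY := by
  simp [testWord]

theorem two_not_mem : (2 : ℕ) ∉ (List.range n).map letterZ ++
    1 :: (List.replicate m 0 ++ alternating n ++ [0]) ∧
      (2 : ℕ) ∉ (List.range n).map letterY := by
  constructor
  · simp only [List.mem_append, List.mem_cons, List.mem_map, List.mem_replicate, mem_alternating,
      letterY, letterZ, List.not_mem_nil]
    grind
  · simp only [List.mem_map, letterY]
    omega

theorem count_one_testWord : (testWord m n).count 1 = 1 := by
  rw [testWord, List.count_append, List.count_cons_self,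
    List.count_eq_zero.2 (one_not_mem (m := m)).1, List.count_eq_zero.2 one_not_mem.2]

theorem pair_one_testWord {c : ℕ} (hc : c ≠ 1) :
    [c, 1].Sublist (testWord m n) ↔ c ∈ (List.range n).map letterZ :=
  (pair_sublist_split hc (one_not_mem (m := 0)).1 one_not_mem.2).1

theorem two_pair_testWord {c : ℕ} (hc : c ≠ 2) :
    [2, c].Sublist (testWord m n) ↔ c ∈ (List.range n).map letterY := by
  rw [testWord_eq]
  exact (pair_sublist_split hc two_not_mem.1 (two_not_mem (m := 0)).2).2

theorem count_testWord {c : ℕ} (h0 : c ≠ 0) (h1 : c ≠ 1) (h2 : c ≠ 2) :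
    (testWord m n).count c ≠ 1 := by
  by_cases hc : c ∈ alternating n
  · have h := List.count_eq_one_of_mem (nodup_alternating n) hc
    have : 0 < ((List.range n).map letterZ).count c + ((List.range n).map letterY).count c := by
      obtain ⟨k, hk, rfl | rfl⟩ := mem_alternating.1 hc
      · rw [count_letterY_map_letterY hk]
        omega
      · rw [count_letterZ_map_letterZ hk]
        omega
    simp only [testWord, List.count_append, List.count_cons, h]
    omega
  · have : c ∉ testWord m n := by
      have h3 : ∀ k < n, c ≠ letterY k ∧ c ≠ letterZ k := fun k hk =>
        ⟨fun h => hc (mem_alternating.2 ⟨k, hk, Or.inl h⟩),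
          fun h => hc (mem_alternating.2 ⟨k, hk, Or.inr h⟩)⟩
      simp only [testWord, List.mem_append, List.mem_cons, List.mem_map, List.mem_range,
        List.mem_replicate, h0, h1, h2, hc, List.not_mem_nil, and_false, or_false, false_or,
        not_or, not_exists, not_and]
      exact ⟨fun k hk h => (h3 k hk).2 h.symm, fun k hk h => (h3 k hk).1 h.symm⟩
    rw [List.count_eq_zero.2 this]
    omega

theorem filter_testWord (m n : ℕ) : (testWord m n).filter (fun c => decide (c ≠ 0)) =
    (testWord 0 n).filter fun c => decide (c ≠ 0) := by
  simp [testWord, List.filter_append]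

/-- The only linear letters are 1 and 2, and every 0 lies between them, so neither separates two
zeros. -/
theorem free_testWord {i : ℕ} (hm : i ≤ m) : Free i 0 (testWord m n) := by
  by_cases h : i + 2 ≤ m + 1
  · exact Or.inl (by rwa [count_zero_testWord])
  · refine Or.inr ⟨by rw [count_zero_testWord]; omega, fun s hs0 hs hb => ?_⟩
    by_cases h1 : s = 1
    · subst h1
      have := (pair_one_testWord (by decide)).1 hb.1
      simp [letterZ] at this
    by_cases h2 : s = 2
    · subst h2
      have := (two_pair_testWord (by decide)).1 hb.2
      simp [letterY] at this
    · exact count_testWord hs0 h1 h2 hs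

/-- Both words reduce to 0^(i+1) followed by the same word without 0. -/
theorem sat_SMonoid_testWord {a t i : ℕ} (hat : a ≠ t) (hi : 1 ≤ i) (n : ℕ) :
    Sat (SMonoid (wordSet a t i)) (testWord i n) (testWord (i + 1) n) := by
  refine sat_of_derives (N := 2 * i + 10) ((derives_of_free hat hi (x := 0)
    (free_testWord le_rfl)).trans ?_)
  rw [filter_testWord, ← filter_testWord (i + 1)]
  exact (derives_of_free hat hi (free_testWord (Nat.le_succ i))).symm

theorem sub2_double {p r : List ℕ} {c : ℕ} (hc : c ∈ r) : Sub2 (p ++ c :: r) (p ++ c :: c :: r) := by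
  refine ⟨fun x => by simp, fun x y => ?_⟩
  simp only [pair_sublist_append, pair_sublist_cons, List.mem_cons]
  constructor
  · tauto
  · rintro (h | ⟨h1, h2⟩ | ⟨rfl, rfl | h⟩ | h)
    · exact Or.inl h
    · exact Or.inr (Or.inl ⟨h1, by tauto⟩)
    · exact Or.inr (Or.inr (Or.inl ⟨rfl, hc⟩))
    · exact Or.inr (Or.inr (Or.inl ⟨rfl, h⟩))
    · exact Or.inr (Or.inr h)

theorem sub2_testWord {i : ℕ} (hi : 1 ≤ i) (n : ℕ) :
    Sub2 (testWord i n) (testWord (i + 1) n) := by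
  obtain ⟨i, rfl⟩ := Nat.exists_eq_add_of_le' hi
  have h := sub2_double (p := (List.range n).map letterZ ++ [1]) (c := 0)
    (r := List.replicate i 0 ++ alternating n ++ [0] ++ 2 :: (List.range n).map letterY) (by simp)
  simpa [testWord, List.replicate_succ] using h

end TestWord

/-! ### Rigidity of the test words and the failure of finite bases -/

theorem replicate_cons_inj {x s k l k' l' : ℕ} (hxs : x ≠ s)
    (h : List.replicate k x ++ s :: List.replicate l x =
      List.replicate k' x ++ s :: List.replicate l' x) : k = k' ∧ l = l' := by
  have h1 : k = k' := by
    induction k generalizing k' with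
    | zero =>
      rcases k' with _ | k'
      · rfl
      · simp [List.replicate_succ, hxs.symm] at h
    | succ k ih =>
      rcases k' with _ | k'
      · simp [List.replicate_succ, hxs] at h
      · rw [ih (k' := k') (by simpa [List.replicate_succ] using h)]
  subst h1
  have := congrArg List.length h
  simp at this
  exact ⟨rfl, this⟩

/-- The properties of `testWord i n` that are inherited by all words equivalent to it. -/
structure Rigid (n : ℕ) (P R : List ℕ) : Prop where
  zero_left : 0 ∉ P
  count_one : (P ++ 1 :: R).count 1 = 1
  count_z : ∀ j < n, R.count (letterZ j) = 1
  y_z : ∀ k < n, ∀ j < n, [letterY k, letterZ j].Sublist (P ++ 1 :: R) ↔ k ≤ j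
  zero_z : ∀ j < n, [0, letterZ j].Sublist (P ++ 1 :: R)
  y_zero : ∀ k < n, [letterY k, 0].Sublist (P ++ 1 :: R)

/-- The order conditions come from A₀¹; the multiplicity of `letterZ j` to the right of 1 comes from
S(W_i). -/
theorem exists_rigid {a t i n : ℕ} (hat : a ≠ t) (hi : 1 ≤ i) {w : List ℕ}
    (hs : Sat (SMonoid (wordSet a t i)) (testWord i n) w) (h2 : Sub2 (testWord i n) w) :
    ∃ P R, w = P ++ 1 :: R ∧ Rigid n P R := by
  have hw1 : w.count 1 = 1 := by
    rw [count_eq_of_sat hi hs (by rw [count_one_testWord]; exact hi), count_one_testWord]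
  obtain ⟨P, R, rfl, hP, hR⟩ := exists_linear_split hw1
  have hleft : ∀ c, c ≠ 1 → (c ∈ P ↔ c ∈ (List.range n).map letterZ) := fun c hc => by
    rw [← pair_one_testWord (m := i) hc, h2.2, (pair_sublist_split hc hP hR).1]
  refine ⟨P, R, rfl, ⟨?_, hw1, ?_, ?_, ?_, ?_⟩⟩
  · rw [hleft 0 (by decide)]
    simp [letterZ]
  · intro j hj
    have hz1 : letterZ j ≠ 1 := by simp only [letterZ]; omega
    have hz : letterZ j ∈ alternating n := mem_alternating.2 ⟨j, hj, Or.inr rfl⟩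
    have hcz : ((List.replicate i 0 ++ alternating n ++ [0]) ++
        2 :: (List.range n).map letterY).count (letterZ j) = 1 := by
      have hy : letterZ j ∉ (List.range n).map letterY := by
        simp only [List.mem_map, letterY, letterZ]
        omega
      simp only [List.count_append, List.count_eq_one_of_mem (nodup_alternating n) hz,
        List.count_replicate, List.count_cons, List.count_eq_zero.2 hy]
      simp [letterZ]
    have hcount : (testWord i n).count (letterZ j) = 2 := by
      rw [testWord, List.count_append, List.count_cons_of_ne hz1.symm, hcz,
        count_letterZ_map_letterZ hj]
    -- For i = 1 the two occurrences of `letterZ j` already number i + 1, so it matters that they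
    -- lie on both sides of 1.
    have heq := restrict_eq_of_sat hat hi hs hz1 count_one_testWord (by omega)
      (Or.inr ⟨(pair_one_testWord hz1).2 (List.mem_map_of_mem (List.mem_range.2 hj)),
        (pair_sublist_split hz1 (one_not_mem (m := 0)).1 one_not_mem.2).2.2 (by simp [hz])⟩)
    rw [testWord, restrict_split (one_not_mem (m := 0)).1 one_not_mem.2, restrict_split hP hR] at heq
    rw [← (replicate_cons_inj hz1 heq).2, hcz]
  · intro k hk j hj
    rw [← h2.2, ← pair_sublist_alternating hj hk]
    have e1 : letterY k ∉ (List.range n).map letterZ := by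
      simp only [List.mem_map, letterY, letterZ]
      omega
    have e2 : letterZ j ∉ 2 :: (List.range n).map letterY := by
      simp only [List.mem_map, List.mem_cons, letterY, letterZ]
      omega
    have e3 : letterY k ∉ List.replicate i 0 := by simp [letterY]
    have e4 : letterZ j ∉ [0] := by simp [letterZ]
    have n1 : ¬ [letterY k, letterZ j].Sublist ((List.range n).map letterZ) :=
      fun h => e1 (mem_of_pair_sublist h).1
    have n2 : ¬ [letterY k, letterZ j].Sublist (2 :: (List.range n).map letterY) :=
      fun h => e2 (mem_of_pair_sublist h).2
    have n3 : ¬ [letterY k, letterZ j].Sublist (List.replicate i 0) :=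
      fun h => e3 (mem_of_pair_sublist h).1
    have n4 : ¬ [letterY k, letterZ j].Sublist [0] := fun h => e4 (mem_of_pair_sublist h).2
    have n5 : letterY k ≠ 1 := by simp only [letterY]; omega
    rw [testWord, pair_sublist_append, pair_sublist_cons, pair_sublist_append,
      pair_sublist_append, pair_sublist_append]
    simp only [n1, n2, n3, n4, n5, e1, e2, e3, e4, false_and, and_false, false_or, or_false]
  · intro j hj
    rw [← h2.2]
    obtain ⟨i, rfl⟩ := Nat.exists_eq_add_of_le' hi
    have hz : letterZ j ∈ alternating n := mem_alternating.2 ⟨j, hj, Or.inr rfl⟩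
    simp [testWord, List.replicate_succ, hz]
  · intro k hk
    rw [← h2.2]
    have hy : letterY k ∈ alternating n := mem_alternating.2 ⟨k, hk, Or.inl rfl⟩
    simp [testWord, pair_sublist_append, pair_sublist_cons, hy]

theorem count_flatMap_congr {θ : ℕ → List ℕ} {x : ℕ} {α β : List ℕ}
    (hm : ∀ ξ, ξ ∈ α ↔ ξ ∈ β) (h : ∀ ξ, x ∈ θ ξ → α.count ξ = β.count ξ) :
    (α.flatMap θ).count x = (β.flatMap θ).count x := by
  have hfin : α.toFinset = β.toFinset := by
    ext ξ
    simp [hm]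
  rw [List.count_flatMap, List.count_flatMap, Finset.sum_list_map_count,
    Finset.sum_list_map_count, hfin]
  refine Finset.sum_congr rfl fun ξ _ => ?_
  by_cases hx : x ∈ θ ξ
  · rw [h ξ hx]
  · simp [List.count_eq_zero.2 hx]

/-- A factor of a rigid word containing all occurrences of `0` and no linear letter cannot be
covered by few images of repeated letters. -/
theorem length_of_cover {n : ℕ} {P R c d α₀ B α₂ : List ℕ} {θ : ℕ → List ℕ}
    (hr : Rigid n P R)
    (hw : P ++ 1 :: R = c ++ (α₀ ++ B ++ α₂).flatMap θ ++ d)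
    (hB : ∀ η ∈ B, 2 ≤ (α₀ ++ B ++ α₂).count η)
    (h0 : 0 ∈ B.flatMap θ) (h0l : 0 ∉ c ++ α₀.flatMap θ) (h0r : 0 ∉ α₂.flatMap θ ++ d) :
    n ≤ B.length + 1 := by
  set w := P ++ 1 :: R with hwdef
  set G := B.flatMap θ with hG
  set l := c ++ α₀.flatMap θ with hl
  set r := α₂.flatMap θ ++ d with hrr
  have hw' : w = l ++ G ++ r := by
    rw [hw]
    simp [hl, hG, hrr, List.flatMap_append]
  have hlin : ∀ s, w.count s = 1 → s ∉ G := by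
    intro s hs hsG
    obtain ⟨η, hη, hsη⟩ := List.mem_flatMap.1 hsG
    have h1 := hB η hη
    have h2 := count_le_count_flatMap hsη (α₀ ++ B ++ α₂)
    have h3 : ((α₀ ++ B ++ α₂).flatMap θ).count s ≤ w.count s := by
      rw [hw, List.count_append, List.count_append]
      omega
    omega
  have h1G := hlin 1 hr.count_one
  -- `G` avoids the linear letter 1, so it lies on one side of it; it contains 0, which is absent
  -- from `P`.
  obtain ⟨e, hR, -⟩ : ∃ e, R = e ++ G ++ r ∧ l = P ++ 1 :: e := by
    rcases block_of_not_mem hw' h1G with ⟨e, he, _⟩ | h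
    · exact absurd (he ▸ by simp [h0]) hr.zero_left
    · exact h
  have hzc : ∀ j < n, e.count (letterZ j) + G.count (letterZ j) + r.count (letterZ j) = 1 := by
    intro j hj
    rw [← hr.count_z j hj, hR, List.count_append (l₂ := r), List.count_append (l₂ := G)]
  have hpairs : ∀ {x y : ℕ}, [x, y].Sublist w → x ∉ l → y ∈ G ++ r := by
    intro x y h hx
    rw [hw', List.append_assoc] at h
    rcases pair_sublist_append.1 h with h | h | h
    · exact absurd (mem_of_pair_sublist h).1 hx
    · exact absurd h.1 hx
    · exact (mem_of_pair_sublist h).2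
  -- Some 0 precedes `letterZ j`, so the latter occurs in `G` or in `r`. In `r` it would come after
  -- `letterY (j + 1)`, which precedes a 0, contrary to the order of the pairs.
  have hzG : ∀ j, j + 1 < n → letterZ j ∈ G := by
    intro j hj
    have hmem : letterZ j ∈ G ++ r := hpairs (hr.zero_z j (by omega)) h0l
    rcases List.mem_append.1 hmem with h | h
    · exact h
    · have hy : letterY (j + 1) ∈ l ++ G := by
        have := hr.y_zero (j + 1) hj
        change [letterY (j + 1), 0].Sublist w at this
        rw [hw'] at this
        rcases pair_sublist_append.1 this with h | h | h
        · exact (mem_of_pair_sublist h).1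
        · exact absurd h.2 h0r
        · exact absurd (mem_of_pair_sublist h).2 h0r
      have hyz : [letterY (j + 1), letterZ j].Sublist w := by
        rw [hw']
        exact pair_sublist_append.2 (Or.inr (Or.inl ⟨hy, h⟩))
      have := (hr.y_z (j + 1) hj j (by omega)).1 hyz
      omega
  -- If the image of η contains z_j and z_k with j < k, then y_k is not to its left (else y_k
  -- precedes z_j) and z_k is not to its right (multiplicity), so y_k lies in the image as well. A
  -- second η then puts y_k on the left or z_k on the right.
  have honce : ∀ η ∈ B, ∀ j k, j < k → k < n → letterZ j ∈ θ η → letterZ k ∈ θ η → False := by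
    intro η hη j k hjk hk hj' hk'
    obtain ⟨B₁, B₂, rfl⟩ := List.append_of_mem hη
    have hw2 : w = (l ++ B₁.flatMap θ) ++ (θ η ++ (B₂.flatMap θ ++ r)) := by
      rw [hw', hG]
      simp [List.flatMap_append]
    have hzk : letterZ k ∉ B₂.flatMap θ ++ r := by
      intro h
      have h1 := hzc k hk
      have h2 := List.count_pos_iff.2 h
      have h3 := List.count_pos_iff.2 hk'
      rw [hG, List.flatMap_append, List.flatMap_cons] at h1
      simp only [List.count_append] at h1 h2
      omega
    have hyk : letterY k ∉ l ++ B₁.flatMap θ := by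
      intro h
      have : [letterY k, letterZ j].Sublist w := by
        rw [hw2]
        exact pair_sublist_append.2 (Or.inr (Or.inl ⟨h, List.mem_append_left _ hj'⟩))
      have := (hr.y_z k hk j (by omega)).1 this
      omega
    have hykη : letterY k ∈ θ η := by
      have h : [letterY k, letterZ k].Sublist w := (hr.y_z k hk k hk).2 le_rfl
      rw [hw2] at h
      rcases pair_sublist_append.1 h with h | h | h
      · exact absurd (mem_of_pair_sublist h).1 hyk
      · exact absurd h.1 hyk
      · rcases pair_sublist_append.1 h with h | h | h
        · exact (mem_of_pair_sublist h).1
        · exact h.1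
        · exact absurd (mem_of_pair_sublist h).2 hzk
    have hcount := hB η hη
    have hη' : η ∈ α₀ ++ B₁ ∨ η ∈ B₂ ++ α₂ := by
      by_contra hcon
      rw [not_or] at hcon
      have h1 := List.count_eq_zero.2 hcon.1
      have h2 := List.count_eq_zero.2 hcon.2
      simp only [List.count_append, List.count_cons_self] at h1 h2 hcount
      omega
    rcases hη' with h | h
    · refine hyk ?_
      rcases List.mem_append.1 h with h | h
      · exact List.mem_append_left _ (List.mem_append_right _ (List.mem_flatMap.2 ⟨η, h, hykη⟩))
      · exact List.mem_append_right _ (List.mem_flatMap.2 ⟨η, h, hykη⟩)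
    · refine hzk ?_
      rcases List.mem_append.1 h with h | h
      · exact List.mem_append_left _ (List.mem_flatMap.2 ⟨η, h, hk'⟩)
      · exact List.mem_append_right _ (List.mem_append_left _ (List.mem_flatMap.2 ⟨η, h, hk'⟩))
  have hex : ∀ j, ∃ η, j + 1 < n → η ∈ B ∧ letterZ j ∈ θ η := by
    intro j
    by_cases hj : j + 1 < n
    · obtain ⟨η, h1, h2⟩ := List.mem_flatMap.1 (hzG j hj)
      exact ⟨η, fun _ => ⟨h1, h2⟩⟩
    · exact ⟨0, fun h => absurd h hj⟩
  choose g hg using hex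
  -- The choice of a letter of `B` covering `letterZ j` is injective on the n - 1 indices j with j +
  -- 1 < n.
  have hcard : (Finset.range (n - 1)).card ≤ B.toFinset.card := by
    refine Finset.card_le_card_of_injOn g ?_ ?_
    · intro j hj
      have hj' := Finset.mem_range.1 hj
      exact List.mem_toFinset.2 (hg j (by omega)).1
    · intro j hj k hk hjk
      have hj' : j < n - 1 := Finset.mem_range.1 hj
      have hk' : k < n - 1 := Finset.mem_range.1 hk
      have h1 := hg j (by omega)
      have h2 := hg k (by omega)
      rw [← hjk] at h2
      by_contra hne
      rcases Nat.lt_or_gt_of_ne hne with h | h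
      · exact honce _ h1.1 j k h (by omega) h1.2 h2.2
      · exact honce _ h1.1 k j h (by omega) h2.2 h1.2
  have := List.toFinset_card_le B
  rw [Finset.card_range] at hcard
  omega

section

variable {a t i : ℕ}

/-- The word `w` is equivalent to `testWord i n` over `A₀¹ × S(W_i)`, and `0` occurs in `w` exactly
`i + 1` times. -/
def Reachable (a t i n : ℕ) (w : List ℕ) : Prop :=
  Sat (SMonoid (wordSet a t i)) (testWord i n) w ∧ Sub2 (testWord i n) w ∧ w.count 0 = i + 1

/-- Short identities of `A₀¹ × S(W_i)` do not change the number of occurrences of `0`. -/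
theorem Reachable.count_eq (hat : a ≠ t) (hi : 1 ≤ i) {n : ℕ} {c d α β : List ℕ}
    {θ : ℕ → List ℕ} (hs : Sat (SMonoid (wordSet a t i)) α β) (h2 : Sub2 α β)
    (hn : α.length + 1 < n) (hw : Reachable a t i n (c ++ α.flatMap θ ++ d)) :
    (α.flatMap θ).count 0 = (β.flatMap θ).count 0 := by
  obtain ⟨hws, hw2, hw0⟩ := hw
  by_contra hne
  obtain ⟨ξ, hξ, hξc⟩ : ∃ ξ, 0 ∈ θ ξ ∧ α.count ξ ≠ β.count ξ := by
    by_contra! hcon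
    exact hne (count_flatMap_congr h2.1 hcon)
  have hge : i + 1 ≤ α.count ξ := by
    by_contra hlt
    exact hξc (count_eq_of_sat hi hs (by omega)).symm
  have hle := count_le_count_flatMap hξ α
  simp only [List.count_append] at hw0
  -- A linear letter between two ξ would make S(W_i) preserve the number of ξ.
  have hbetween : ∀ s, ξ ≠ s → α.count s = 1 → ¬ ([ξ, s].Sublist α ∧ [s, ξ].Sublist α) := by
    intro s hξs hcs hb
    have heq := restrict_eq_of_sat hat hi hs hξs hcs (by omega) (Or.inr hb)
    exact hξc (by rw [← count_restrict_left ξ s α, heq, count_restrict_left])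
  obtain ⟨α₀, α', rfl, h0⟩ :=
    List.eq_append_cons_of_mem (List.count_pos_iff.1 (by omega : 0 < α.count ξ))
  have hα0 := List.count_eq_zero.2 h0
  have hα' : 0 < α'.count ξ := by
    simp only [List.count_append, List.count_cons_self] at hge
    omega
  obtain ⟨α₁, α₂, rfl, h2'⟩ := exists_last_occurrence (List.count_pos_iff.1 hα')
  have hα2 := List.count_eq_zero.2 h2'
  have hsplit : α₀ ++ ξ :: (α₁ ++ ξ :: α₂) = α₀ ++ (ξ :: (α₁ ++ [ξ])) ++ α₂ := by simp
  obtain ⟨P, R, hPR, hrigid⟩ := exists_rigid hat hi hws hw2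
  rw [hsplit] at hPR hge hbetween hw0 hle hn
  -- The whole word has i+1 zeros and ξ occurs at least i+1 times, each time contributing a zero. So
  -- the stretch from the first to the last ξ covers all the zeros.
  set B := ξ :: (α₁ ++ [ξ]) with hB
  have hBξ : B.count ξ = (α₀ ++ B ++ α₂).count ξ := by
    rw [List.count_append, List.count_append, hα0, hα2]
    omega
  have hG := count_le_count_flatMap hξ B
  have hflat : ((α₀ ++ B ++ α₂).flatMap θ).count 0 =
      (α₀.flatMap θ).count 0 + (B.flatMap θ).count 0 + (α₂.flatMap θ).count 0 := by
    simp only [List.flatMap_append, List.count_append]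
  have hlen := length_of_cover hrigid hPR.symm
    (by
      intro η hη
      by_cases hηξ : η = ξ
      · rw [hηξ]
        omega
      · have hη1 : η ∈ α₁ := by simpa [hB, hηξ] using hη
        have hpos : 0 < (α₀ ++ B ++ α₂).count η := List.count_pos_iff.2 (by simp [hη])
        have hne1 : (α₀ ++ B ++ α₂).count η ≠ 1 := fun h1 =>
          hbetween η (Ne.symm hηξ) h1
            ⟨by simp [hB, hη1],
              by simp [hB, pair_sublist_append, pair_sublist_cons, hη1]⟩
        omega)
    (List.count_pos_iff.1 (by omega))
    (by
      rw [← List.count_eq_zero, List.count_append]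
      omega)
    (by
      rw [← List.count_eq_zero, List.count_append]
      omega)
  simp only [List.length_append] at hn
  omega

theorem Reachable.of_identity (hat : a ≠ t) (hi : 1 ≤ i) {n : ℕ} {c d α β : List ℕ}
    {θ : ℕ → List ℕ} (hs : Sat (SMonoid (wordSet a t i)) α β) (h2 : Sat A0One α β)
    (hn : α.length + 1 < n) (hw : Reachable a t i n (c ++ α.flatMap θ ++ d)) :
    Reachable a t i n (c ++ β.flatMap θ ++ d) := by
  have hc := hw.count_eq hat hi hs (sat_A0One_iff.1 h2) hn
  refine ⟨hw.1.trans ((hs.subst θ).context c d),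
    hw.2.1.trans (sat_A0One_iff.1 ((h2.subst θ).context c d)), ?_⟩
  have := hw.2.2
  simp only [List.count_append] at this ⊢
  omega

theorem not_finitelyBased_prod (hat : a ≠ t) (hi : 1 ≤ i) :
    ¬ FinitelyBased (A0One × SMonoid (wordSet a t i)) := by
  rintro ⟨E, hE, hsat, hded⟩
  obtain ⟨N, hN⟩ := (hE.image fun e : Identity =>
    max (toWord e.1).length (toWord e.2).length).bddAbove
  have hlen : ∀ e ∈ E, (toWord e.1).length ≤ N ∧ (toWord e.2).length ≤ N := fun e he =>
    max_le_iff.1 (hN ⟨e, he, rfl⟩)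
  have hE' : ∀ e ∈ E, Sat A0One (toWord e.1) (toWord e.2) ∧
      Sat (SMonoid (wordSet a t i)) (toWord e.1) (toWord e.2) := fun e he =>
    sat_prod_iff.1 ((satisfies_iff e).1 (hsat e he))
  -- Ensures length + 1 < n for both sides of every identity in `E`, as `Reachable.of_identity`
  -- requires.
  set n := N + 2
  have hne : ∀ m, testWord m n ≠ [] := fun m h => by simp [testWord] at h
  obtain ⟨p, hp⟩ := exists_toWord (hne i)
  obtain ⟨q, hq⟩ := exists_toWord (hne (i + 1))
  -- Quantifying over all contexts turns invariance of `Reachable` into a congruence, so it passes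
  -- from single applications to deductions. It separates the two test words, which have i+1 and i+2
  -- zeros.
  let K : Con (FreeSemigroup ℕ) :=
    { r := fun p q => ∀ c d, Reachable a t i n (c ++ toWord p ++ d) ↔
        Reachable a t i n (c ++ toWord q ++ d)
      iseqv := ⟨fun _ _ _ => Iff.rfl, fun h c d => (h c d).symm,
        fun h k c d => (h c d).trans (k c d)⟩
      mul' := by
        intro p q p' q' h h' c d
        have h1 := h c (toWord p' ++ d)
        have h2 := h' (c ++ toWord q) d
        simp only [toWord_mul, List.append_assoc] at h1 h2 ⊢
        exact h1.trans h2 }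
  have hle : conGen (fun p q : FreeSemigroup ℕ => ∃ f ∈ E,
      ∃ Θ : FreeSemigroup ℕ →ₙ* FreeSemigroup ℕ, p = Θ f.1 ∧ q = Θ f.2) ≤ K := by
    refine Con.conGen_le.2 ?_
    rintro _ _ ⟨f, hf, Θ, rfl, rfl⟩ c d
    have h1 := hE' f hf
    have h2 := hlen f hf
    rw [toWord_map, toWord_map]
    exact ⟨fun h => h.of_identity hat hi h1.2 h1.1 (by omega),
      fun h => h.of_identity hat hi h1.2.symm h1.1.symm (by omega)⟩
  have hpq : Satisfies (A0One × SMonoid (wordSet a t i)) (p, q) := by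
    rw [satisfies_iff, hp, hq, sat_prod_iff, sat_A0One_iff]
    exact ⟨sub2_testWord hi n, sat_SMonoid_testWord hat hi n⟩
  have hK := hle (hded (p, q) hpq) [] []
  simp only [List.nil_append, List.append_nil, hp, hq] at hK
  have hstart : Reachable a t i n (testWord i n) :=
    ⟨Sat.refl _, ⟨fun _ => Iff.rfl, fun _ _ => Iff.rfl⟩, count_zero_testWord⟩
  have := (hK.1 hstart).2.2
  rw [count_zero_testWord] at this
  omega

end

end FiniteBasis

theorem mainTheorem9 (a t : FiniteBasis.Alphabet) (hat : a ≠ t) :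
    FiniteBasis.FinitelyBased FiniteBasis.A0One ∧
      ∀ i : ℕ, 1 ≤ i →
        FiniteBasis.FinitelyBased (FiniteBasis.SMonoid (FiniteBasis.wordSet a t i)) ∧
        ¬ FiniteBasis.FinitelyBased
          (FiniteBasis.A0One × FiniteBasis.SMonoid (FiniteBasis.wordSet a t i)) :=
  ⟨FiniteBasis.finitelyBased_A0One, fun _ hi =>
    ⟨FiniteBasis.finitelyBased_SMonoid hat hi, FiniteBasis.not_finitelyBased_prod hat hi⟩⟩
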